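/- Let $n\ge 2$, $1<p<\infty$, let $\Omega\subset\mathbb R^n$ be a bounded open set, and let $\sigma\in L^\infty(\Omega)$ be real-valued with $\operatorname{ess\,inf}_\Omega\sigma>0$. Assume that either $\sigma\ge 1$ a.e. in $\Omega$ or $\sigma\le 1$ a.e. in $\Omega$. Let $m$ denote Lebesgue measure on $\mathbb R^n$; measurability is Lebesgue measurability. **Notation.** Let $X=W^{1,p}(\Omega)/W^{1,p}_0(\Omega)$, where $W^{1,p}_0(\Omega)$ is the closure of $C_c^\infty(\Omega)$ in $W^{1,p}(\Omega)$. For a conductivity $\gamma\in L^\infty(\Omega)$ with $\operatorname{ess\,inf}\gamma>0$ and for $f\in X$, let $u_\gamma^f$ be the unique minimizer of $u\mapsto\int_\Omega\gamma|\nabla u|^p\,dx$ in the coset $f$. The Dirichlet-to-Neumann map $\Lambda_\gamma$ is given by $$(\Lambda_\gamma(f),g)=\int_\Omega\gamma|\nabla u_\gamma^f|^{p-2}\nabla u_\gamma^f\cdot\nabla v^g\,dx,\qquad f,g\in X,$$ where $v^g\in W^{1,p}(\Omega)$ is any representative of $g$. Write $\Lambda_0$ and $u_0^f$ for $\Lambda_\gamma$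 and $u_\gamma^f$ with $\gamma\equiv 1$. For measurable $B\subseteq\Omega$ put $$(\Lambda_B(f),g)=\int_B|\nabla u_0^f|^{p-2}\nabla u_0^f\cdot\nabla u_0^g\,dx,\qquad f,g\in X.$$ For such operators, $T\le S$ (equivalently $S\ge T$) means that $(S(f)-T(f),f)\ge 0$ for all $f\in X$. For measurable $f:\Omega\to\mathbb R$, $\operatorname{ess\,supp}f$ is the complement in $\Omega$ of the union of all open sets $O\subseteq\Omega$ with $f|_O=0$ a.e. For measurable $A\subseteq\mathbb R^n$, the measure-theoretic interior $A^\circ$ is the set of all $x\in A$ with $\lim_{\epsilon\to0}m(A\cap B_\epsilon(x))/m(B_\epsilon(x))=1$, and the closed essential convex hull $\operatorname{cessco}A$ is the intersection of all closed half spaces $H_{\rho,t}=\{x\in\mathbb R^n: x\cdot\rho\le t\}$ ($\rho\in\mathbb R^n$, $t\in\mathbb R$) with $m(A\setminus H_{\rho,t})=0$. **Claim.** Let $\mathcal B$ be the family of all measurable sets $B\subseteq\Omega$ for which there is an $\alpha>0$ such that $\Lambda_0+\alpha\Lambda_B\le\Lambda_\sigma$ or $\Lambda_0-\alpha\Lambda_B\ge\Lambda_\sigma$.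 Then $$\operatorname{cessco}\bigl(\operatorname{ess\,supp}|\sigma-1|\bigr)=\operatorname{cessco}\Bigl(\bigcup_{B\in\mathcal B}B^\circ\Bigr).$$ -/

import Mathlib

open MeasureTheory Filter Topology Set
open scoped ENNReal ContDiff

namespace PCalderon

noncomputable section

/-- `ℝⁿ` with the Euclidean norm. -/
abbrev E (n : ℕ) : Type := EuclideanSpace ℝ (Fin n)

/-! ### Essential support, measure-theoretic interior, closed essential convex hull -/

/-- The essential support of `f : Ω → ℝ`: the complement in `Ω` of the union of all open subsets
of `Ω` on which `f` vanishes almost everywhere. (Values of `f` outside `Ω` play no role.) -/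
def esssupp {n : ℕ} (Ω : Set (E n)) (f : E n → ℝ) : Set (E n) :=
  Ω \ ⋃₀ {O | IsOpen O ∧ O ⊆ Ω ∧ ∀ᵐ x ∂(volume.restrict O), f x = 0}

/-- The measure-theoretic interior of `A`: the points of `A` at which `A` has density `1`. -/
def mtInterior {n : ℕ} (A : Set (E n)) : Set (E n) :=
  {x ∈ A | Tendsto (fun ε : ℝ => volume (A ∩ Metric.ball x ε) / volume (Metric.ball x ε))
    (𝓝[>] 0) (𝓝 1)}

/-- The closed half space `{x : x · ρ ≤ t}`; `ρ` is an arbitrary vector. -/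
def halfSpace {n : ℕ} (ρ : E n) (t : ℝ) : Set (E n) := {x | inner ℝ x ρ ≤ t}

/-- The closed essential convex hull of `A`: the intersection of all closed half spaces that
contain `A` up to a Lebesgue null set. -/
def cessco {n : ℕ} (A : Set (E n)) : Set (E n) :=
  {x | ∀ (ρ : E n) (t : ℝ), volume (A \ halfSpace ρ t) = 0 → x ∈ halfSpace ρ t}

/-! ### Sobolev spaces -/

instance factOneLeOfReal (p : ℝ) [hp : Fact (1 < p)] : Fact (1 ≤ ENNReal.ofReal p) :=
  ⟨by simpa using hp.out.le⟩

/-- Smooth real functions with compact support contained in `Ω`. -/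
def IsTest {n : ℕ} (Ω : Set (E n)) (φ : E n → ℝ) : Prop :=
  ContDiff ℝ ∞ φ ∧ HasCompactSupport φ ∧ tsupport φ ⊆ Ω

/-- `G` is a weak gradient of `u` on `Ω`: `∫_Ω u ∂_v φ = - ∫_Ω φ G · v` for all test functions `φ`
and all directions `v`. -/
def IsWeakGrad {n : ℕ} (Ω : Set (E n)) (u : E n → ℝ) (G : E n → E n) : Prop :=
  ∀ φ : E n → ℝ, IsTest Ω φ → ∀ v : E n,
    ∫ x in Ω, u x * fderiv ℝ φ x v = - ∫ x in Ω, φ x * inner ℝ (G x) v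

section Sobolev

variable {n : ℕ} (p : ℝ) [hp : Fact (1 < p)] (Ω : Set (E n))

theorem integrable_mul_of_memLp {u φ : E n → ℝ}
    (hu : MemLp u (ENNReal.ofReal p) (volume.restrict Ω)) (hφ : Continuous φ)
    (hc : HasCompactSupport φ) : Integrable (fun x => u x * φ x) (volume.restrict Ω) := by
  have h := (hu.locallyIntegrable Fact.out).integrable_smul_right_of_hasCompactSupport hφ hc
  simpa [smul_eq_mul] using h

theorem IsTest.integrable_left {u φ : E n → ℝ}
    (hu : MemLp u (ENNReal.ofReal p) (volume.restrict Ω)) (hφ : IsTest Ω φ) (v : E n) :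
    Integrable (fun x => u x * fderiv ℝ φ x v) (volume.restrict Ω) := by
  refine integrable_mul_of_memLp p Ω hu ?_ ?_
  · exact (hφ.1.continuous_fderiv (by simp)).clm_apply continuous_const
  · exact hφ.2.1.fderiv_apply (𝕜 := ℝ) v

theorem IsTest.integrable_right {G : E n → E n} {φ : E n → ℝ}
    (hG : MemLp G (ENNReal.ofReal p) (volume.restrict Ω)) (hφ : IsTest Ω φ) (v : E n) :
    Integrable (fun x => φ x * inner ℝ (G x) v) (volume.restrict Ω) := by
  have h := integrable_mul_of_memLp p Ω (hG.inner_const v) hφ.1.continuous hφ.2.1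
  simpa [mul_comm] using h

/-- The Sobolev space `W^{1,p}(Ω)`, realised as the (closed) subspace of `L^p(Ω) × L^p(Ω; ℝⁿ)` of
all pairs `(u, ∇u)` with `∇u` the weak gradient of `u`. The norm is the maximum of the two `L^p`
norms, which is equivalent to the usual one. -/
def W1p : Submodule ℝ
    (Lp ℝ (ENNReal.ofReal p) (volume.restrict Ω) ×
      Lp (E n) (ENNReal.ofReal p) (volume.restrict Ω)) where
  carrier := {w | IsWeakGrad Ω w.1 w.2}
  zero_mem' := by
    intro φ _ v
    have h1 : ∫ x in Ω, (0 : Lp ℝ (ENNReal.ofReal p) (volume.restrict Ω)) x * fderiv ℝ φ x v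
        = 0 := by
      refine integral_eq_zero_of_ae ?_
      filter_upwards [Lp.coeFn_zero ℝ (ENNReal.ofReal p) (volume.restrict Ω)] with x hx
      rw [hx]
      simp only [Pi.zero_apply, zero_mul]
    have h2 : ∫ x in Ω, φ x * inner ℝ
        ((0 : Lp (E n) (ENNReal.ofReal p) (volume.restrict Ω)) x) v = 0 := by
      refine integral_eq_zero_of_ae ?_
      filter_upwards [Lp.coeFn_zero (E n) (ENNReal.ofReal p) (volume.restrict Ω)] with x hx
      rw [hx]
      simp only [Pi.zero_apply, inner_zero_left, mul_zero]
    simp only [Prod.fst_zero, Prod.snd_zero]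
    rw [h1, h2, neg_zero]
  add_mem' := by
    intro a b ha hb φ hφ v
    have h1 : ∫ x in Ω, (a + b).1 x * fderiv ℝ φ x v
        = ∫ x in Ω, (a.1 x * fderiv ℝ φ x v + b.1 x * fderiv ℝ φ x v) := by
      refine integral_congr_ae ?_
      filter_upwards [Lp.coeFn_add a.1 b.1] with x hx
      simp only [Prod.fst_add, hx, Pi.add_apply, add_mul]
    have h2 : ∫ x in Ω, φ x * inner ℝ ((a + b).2 x) v
        = ∫ x in Ω, (φ x * inner ℝ (a.2 x) v + φ x * inner ℝ (b.2 x) v) := by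
      refine integral_congr_ae ?_
      filter_upwards [Lp.coeFn_add a.2 b.2] with x hx
      simp only [Prod.snd_add, hx, Pi.add_apply, inner_add_left, mul_add]
    rw [h1, h2, integral_add (hφ.integrable_left p Ω (Lp.memLp a.1) v)
      (hφ.integrable_left p Ω (Lp.memLp b.1) v),
      integral_add (hφ.integrable_right p Ω (Lp.memLp a.2) v)
      (hφ.integrable_right p Ω (Lp.memLp b.2) v), ha φ hφ v, hb φ hφ v]
    ring
  smul_mem' := by
    intro c a ha φ hφ v
    have h1 : ∫ x in Ω, (c • a).1 x * fderiv ℝ φ x v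
        = ∫ x in Ω, c * (a.1 x * fderiv ℝ φ x v) := by
      refine integral_congr_ae ?_
      filter_upwards [Lp.coeFn_smul c a.1] with x hx
      simp only [Prod.smul_fst, hx, Pi.smul_apply, smul_eq_mul, mul_assoc]
    have h2 : ∫ x in Ω, φ x * inner ℝ ((c • a).2 x) v
        = ∫ x in Ω, c * (φ x * inner ℝ (a.2 x) v) := by
      refine integral_congr_ae ?_
      filter_upwards [Lp.coeFn_smul c a.2] with x hx
      simp only [Prod.smul_snd, hx, Pi.smul_apply, real_inner_smul_left]
      ring
    rw [h1, h2, integral_const_mul, integral_const_mul, ha φ hφ v]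
    ring

/-- The gradient of a Sobolev function. -/
def grad {p : ℝ} [Fact (1 < p)] {Ω : Set (E n)} (u : W1p p Ω) : E n → E n := u.1.2

/-- The elements of `W^{1,p}(Ω)` that are (almost everywhere equal to) test functions. -/
def testSubspace : Submodule ℝ (W1p p Ω) where
  carrier := {w | ∃ φ : E n → ℝ, IsTest Ω φ ∧ w.1.1 =ᵐ[volume.restrict Ω] φ}
  zero_mem' := ⟨0, ⟨contDiff_const, HasCompactSupport.zero, by simp [tsupport]⟩,
    Lp.coeFn_zero ℝ (ENNReal.ofReal p) (volume.restrict Ω)⟩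
  add_mem' := by
    rintro a b ⟨φ, hφ, ha⟩ ⟨ψ, hψ, hb⟩
    refine ⟨φ + ψ, ⟨hφ.1.add hψ.1, hφ.2.1.add hψ.2.1,
      (tsupport_add φ ψ).trans (union_subset hφ.2.2 hψ.2.2)⟩, ?_⟩
    exact (Lp.coeFn_add a.1.1 b.1.1).trans (ha.add hb)
  smul_mem' := by
    rintro c a ⟨φ, hφ, ha⟩
    refine ⟨fun x => c • φ x, ⟨hφ.1.const_smul c, hφ.2.1.smul_left (f := fun _ => c),
      (tsupport_smul_subset_right (fun _ => c) φ).trans hφ.2.2⟩, ?_⟩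
    refine (Lp.coeFn_smul c a.1.1).trans ?_
    filter_upwards [ha] with x hx
    simp [hx]

/-- `W^{1,p}_0(Ω)`: the closure of the test functions in `W^{1,p}(Ω)`. -/
def W1p0 : Submodule ℝ (W1p p Ω) := (testSubspace p Ω).topologicalClosure

/-- The space of (abstract) Dirichlet boundary values `X = W^{1,p}(Ω) / W^{1,p}_0(Ω)`. -/
abbrev BdryVal : Type := W1p p Ω ⧸ W1p0 p Ω

end Sobolev

/-! ### Conductivities and the Dirichlet-to-Neumann map -/

/-- `σ ∈ L^∞_+(Ω)`: essentially bounded with positive essential infimum. -/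
def IsConductivity {n : ℕ} (Ω : Set (E n)) (σ : E n → ℝ) : Prop :=
  MemLp σ ∞ (volume.restrict Ω) ∧ ∃ c : ℝ, 0 < c ∧ ∀ᵐ x ∂(volume.restrict Ω), c ≤ σ x

section DN

variable {n : ℕ} {p : ℝ} [Fact (1 < p)] {Ω : Set (E n)}

/-- The `p`-Dirichlet energy `E_σ(u) = ∫_Ω σ |∇u|^p`. -/
def energy (σ : E n → ℝ) (u : W1p p Ω) : ℝ := ∫ x in Ω, σ x * ‖grad u x‖ ^ p

/-- `u` minimizes the energy `E_σ` among all Sobolev functions with boundary value `f`. -/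
def IsMinimizer (σ : E n → ℝ) (f : BdryVal p Ω) (u : W1p p Ω) : Prop :=
  (W1p0 p Ω).mkQ u = f ∧ ∀ v : W1p p Ω, (W1p0 p Ω).mkQ v = f → energy σ u ≤ energy σ v

/-- `u_σ^f`: the minimizer of the energy `E_σ` with boundary value `f` (it exists and is unique
for bounded open `Ω` and `σ ∈ L^∞_+(Ω)`). -/
def sol (σ : E n → ℝ) (f : BdryVal p Ω) : W1p p Ω := Classical.epsilon (IsMinimizer σ f)

/-- `v^g`: a representative in `W^{1,p}(Ω)` of the boundary value `g`. -/
def rep (g : BdryVal p Ω) : W1p p Ω := Function.surjInv (Submodule.mkQ_surjective (W1p0 p Ω)) g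

theorem mkQ_rep (g : BdryVal p Ω) : (W1p0 p Ω).mkQ (rep g) = g := Function.surjInv_eq _ g

variable (p Ω) in
/-- A (possibly nonlinear) operator `T` from boundary values to functionals on boundary values,
given by its pairing `(T f, g)`. -/
abbrev BdryOp : Type := BdryVal p Ω → BdryVal p Ω → ℝ

/-- The Dirichlet-to-Neumann map,
`(Λ_σ f, g) = ∫_Ω σ |∇u_σ^f|^{p-2} ∇u_σ^f · ∇v^g`. -/
def dnMap (σ : E n → ℝ) : BdryOp p Ω := fun f g =>
  ∫ x in Ω, σ x * ‖grad (sol σ f) x‖ ^ (p - 2) * inner ℝ (grad (sol σ f) x) (grad (rep g) x)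

/-- The test operator of a measurable `B ⊆ Ω`,
`(Λ_B f, g) = ∫_B |∇u_0^f|^{p-2} ∇u_0^f · ∇u_0^g`, with `u_0^h` the minimizer of the energy of the
homogeneous conductivity `1` with boundary value `h`. -/
def testOp (B : Set (E n)) : BdryOp p Ω := fun f g =>
  ∫ x in B, ‖grad (sol (fun _ => 1) f) x‖ ^ (p - 2) *
    inner ℝ (grad (sol (fun _ => 1) f) x) (grad (sol (fun _ => 1) g) x)

/-- The preorder on operators: `T ≤ S` iff `((S - T) f, f) ≥ 0` for all `f`. -/
def OpLE (T S : BdryOp p Ω) : Prop := ∀ f : BdryVal p Ω, 0 ≤ (S - T) f f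

variable (p Ω) in
/-- The family of all (Lebesgue) measurable sets `B ⊆ Ω` marked by the monotonicity tests:
`Λ_0 + α Λ_B ≤ Λ_σ` or `Λ_0 - α Λ_B ≥ Λ_σ` for some `α > 0`. -/
def marked (σ : E n → ℝ) : Set (Set (E n)) :=
  {B | B ⊆ Ω ∧ NullMeasurableSet B volume ∧ ∃ α : ℝ, 0 < α ∧
    (OpLE (dnMap (fun _ => 1) + α • testOp B : BdryOp p Ω) (dnMap σ) ∨
      OpLE (dnMap σ) (dnMap (fun _ => 1) - α • testOp B : BdryOp p Ω))}

end DN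

end

end PCalderon

/-! Both hulls are intersections of closed half spaces, so it suffices that a half space H contains
the essential support of |σ - 1| up to a null set exactly when it so contains the union of the
interiors of the marked sets.

The bridge is a two-sided estimate. Let u₀ be the solution for conductivity 1 with boundary value f.
Using u₀ as a competitor for σ bounds (Λ_σ f - Λ_0 f, f) above by ∫ (σ - 1)|∇u₀|^p (`dnMap_sub_le`).
The weak equation for u₀ and Young's inequality with weight σ(x) bound it below by ∫ (p - 1)(1 -
σ^{-1/(p-1)})|∇u₀|^p (`le_dnMap_sub`). Both densities vanish where σ = 1 and have the sign of σ - 1.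

If σ stays on one side of 1, the sets {|σ - 1| ≥ δ} are therefore marked (`mem_marked_of_le`,
`mem_marked_of_ge`), and by the density theorem each agrees with its interior up to a null set.
Countably many δ exhaust {σ ≠ 1}, so if H captures the interiors then σ = 1 a.e. in the open set Ω \
H.

Conversely, let σ = 1 a.e. in Ω \ H and let B be marked. The estimate gives ∫_B |∇u₀|^p ≤ C ∫_{Ω∩H}
|∇u₀|^p with C independent of f (`exists_bound_of_marked`). Wolff's solutions e^{τ x·e₁} w(τ x·e₂),
with e₁ the outer normal of H, have gradients comparable to τ e^{τ x·e₁} (`exists_wolff_solution`).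
As τ → ∞ they are exponentially larger beyond H than inside, which forces m(B \ H) = 0. This
direction needs no sign of σ - 1.

Underneath lies the solvability of the Dirichlet problem (`exists_isMinimizer`,
`IsMinimizer.grad_eq`): the quantitative convexity of `norm_sub_rpow_le` makes minimizing sequences
Cauchy, so no weak compactness is needed. -/

namespace PCalderon

/-! ### Pointwise inequalities for |x|^p and its gradient -/

section Pointwise

variable {F : Type*} [NormedAddCommGroup F] [InnerProductSpace ℝ F]

/-- The nonlinearity `x ↦ |x|^{p-2} x` of the `p`-Laplacian. -/
noncomputable def pflux (p : ℝ) (x : F) : F := ‖x‖ ^ (p - 2) • x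

theorem norm_pflux {p : ℝ} (hp : 1 < p) (x : F) : ‖pflux p x‖ = ‖x‖ ^ (p - 1) := by
  rcases eq_or_ne x 0 with rfl | hx
  · simp [pflux, Real.zero_rpow (by linarith : p - 1 ≠ 0)]
  · have h : 0 < ‖x‖ := norm_pos_iff.2 hx
    rw [pflux, norm_smul, Real.norm_of_nonneg (by positivity), ← Real.rpow_add_one h.ne']
    congr 1; ring

theorem inner_pflux_self {p : ℝ} (hp : 1 < p) (x : F) : inner ℝ (pflux p x) x = ‖x‖ ^ p := by
  rcases eq_or_ne x 0 with rfl | hx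
  · simp [pflux, Real.zero_rpow (by linarith : p ≠ 0)]
  · have h : 0 < ‖x‖ := norm_pos_iff.2 hx
    rw [pflux, real_inner_smul_left, real_inner_self_eq_norm_sq, ← Real.rpow_natCast,
      ← Real.rpow_add h]
    congr 1; push_cast; ring

/-- Only the origin is delicate, since the scalar factor is singular there for p < 2; the norm
|x|^{p-1} still tends to 0. -/
theorem continuous_pflux {p : ℝ} (hp : 1 < p) : Continuous (pflux p : F → F) := by
  rw [continuous_iff_continuousAt]
  intro x
  rcases eq_or_ne x 0 with rfl | hx
  · have h0 : pflux p (0 : F) = 0 := by simp [pflux]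
    rw [ContinuousAt, h0, tendsto_zero_iff_norm_tendsto_zero]
    simp_rw [norm_pflux hp]
    have h : Tendsto (fun x : F => ‖x‖) (𝓝 0) (𝓝 0) := by
      simpa using (continuous_norm (E := F)).tendsto 0
    simpa [Real.zero_rpow (by linarith : p - 1 ≠ 0)] using
      h.rpow_const (p := p - 1) (Or.inr (by linarith))
  · exact (continuous_norm.continuousAt.rpow_const (Or.inl (norm_ne_zero_iff.2 hx))).smul
      continuousAt_id

/-- A weighted Young inequality. -/
theorem inner_pflux_le {p : ℝ} (hp : 1 < p) {s : ℝ} (hs : 0 < s) (a b : F) :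
    p * inner ℝ (pflux p b) a ≤ s * ‖a‖ ^ p + (p - 1) * s ^ (-1 / (p - 1)) * ‖b‖ ^ p := by
  have hp0 : 0 < p := by linarith
  have hp1 : 0 < p - 1 := by linarith
  have hpq : p.HolderConjugate (p / (p - 1)) := Real.HolderConjugate.conjExponent hp
  have h1 : inner ℝ (pflux p b) a ≤ ‖a‖ * ‖b‖ ^ (p - 1) := by
    rw [mul_comm, ← norm_pflux hp]; exact real_inner_le_norm _ _
  -- Distributing 1 = s^{1/p} s^{-1/p} over the two factors produces the weight s on |a|^p.
  have h2 := Real.young_inequality_of_nonneg (a := s ^ (1 / p) * ‖a‖)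
    (b := s ^ (-(1 / p)) * ‖b‖ ^ (p - 1)) (by positivity) (by positivity) hpq
  have e1 : s ^ (1 / p) * ‖a‖ * (s ^ (-(1 / p)) * ‖b‖ ^ (p - 1)) = ‖a‖ * ‖b‖ ^ (p - 1) := by
    have : s ^ (1 / p) * s ^ (-(1 / p)) = 1 := by rw [← Real.rpow_add hs]; simp
    linear_combination ‖a‖ * ‖b‖ ^ (p - 1) * this
  have e2 : (s ^ (1 / p) * ‖a‖) ^ p = s * ‖a‖ ^ p := by
    rw [Real.mul_rpow (by positivity) (by positivity), ← Real.rpow_mul hs.le,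
      one_div_mul_cancel hp0.ne', Real.rpow_one]
  have e3 : (s ^ (-(1 / p)) * ‖b‖ ^ (p - 1)) ^ (p / (p - 1)) = s ^ (-1 / (p - 1)) * ‖b‖ ^ p := by
    rw [Real.mul_rpow (by positivity) (by positivity), ← Real.rpow_mul hs.le,
      ← Real.rpow_mul (norm_nonneg b)]
    congr 2 <;> field_simp
  rw [e1, e2, e3] at h2
  calc p * inner ℝ (pflux p b) a ≤ p * (s * ‖a‖ ^ p / p
        + s ^ (-1 / (p - 1)) * ‖b‖ ^ p / (p / (p - 1))) := by gcongr; exact h1.trans h2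
    _ = _ := by field_simp

/-- The tangent inequality for the convex function |x|^p is Young's inequality with weight 1. -/
theorem norm_rpow_tangent {p : ℝ} (hp : 1 < p) (a b : F) :
    ‖b‖ ^ p + p * inner ℝ (pflux p b) (a - b) ≤ ‖a‖ ^ p := by
  have h := inner_pflux_le hp one_pos a b
  rw [inner_sub_right, inner_pflux_self hp]
  simp only [Real.one_rpow] at h
  linarith

/-- For equal norms the strictness comes from the strict convexity of the norm, for different norms
from that of t^p. -/
theorem norm_midpoint_rpow_lt {p : ℝ} (hp : 1 < p) {a b : F} (hab : a ≠ b) :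
    ‖(1 / 2 : ℝ) • (a + b)‖ ^ p < (‖a‖ ^ p + ‖b‖ ^ p) / 2 := by
  have hp0 : 0 < p := by linarith
  by_cases h : ‖a‖ = ‖b‖
  · have h1 := (norm_midpoint_lt_iff h).2 hab
    have h2 := Real.rpow_lt_rpow (norm_nonneg _) h1 hp0
    rw [← h]; linarith
  · have h1 := (strictConvexOn_rpow hp).2 (norm_nonneg a) (norm_nonneg b) h
      (show (0 : ℝ) < 1 / 2 by norm_num) (show (0 : ℝ) < 1 / 2 by norm_num) (by norm_num)
    simp only [smul_eq_mul] at h1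
    have h2 : ‖(1 / 2 : ℝ) • (a + b)‖ ≤ 1 / 2 * ‖a‖ + 1 / 2 * ‖b‖ := by
      rw [norm_smul, Real.norm_of_nonneg (by norm_num)]
      linarith [norm_add_le a b]
    have h3 := Real.rpow_le_rpow (norm_nonneg _) h2 hp0.le
    linarith

theorem norm_midpoint_rpow_le {p : ℝ} (hp : 1 < p) (a b : F) :
    ‖(1 / 2 : ℝ) • (a + b)‖ ^ p ≤ (‖a‖ ^ p + ‖b‖ ^ p) / 2 := by
  rcases eq_or_ne a b with rfl | h
  · rw [← two_smul ℝ a, smul_smul]; simp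
  · exact (norm_midpoint_rpow_lt hp h).le

/-- A quantitative form of the strict convexity of `|x|^p`. -/
theorem norm_sub_rpow_le [FiniteDimensional ℝ F] {p : ℝ} (hp : 1 < p) {ε : ℝ} (hε : 0 < ε) :
    ∃ C : ℝ, 0 ≤ C ∧ ∀ a b : F, ‖a - b‖ ^ p ≤ ε * (‖a‖ ^ p + ‖b‖ ^ p) +
      C * ((‖a‖ ^ p + ‖b‖ ^ p) / 2 - ‖(1 / 2 : ℝ) • (a + b)‖ ^ p) := by
  have hp0 : 0 < p := by linarith
  have hc : ∀ {f : F × F → F}, Continuous f → Continuous fun x => ‖f x‖ ^ p := fun hf =>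
    hf.norm.rpow_const fun _ => Or.inr hp0.le
  set g : F × F → ℝ := fun x => (‖x.1‖ ^ p + ‖x.2‖ ^ p) / 2 - ‖(1 / 2 : ℝ) • (x.1 + x.2)‖ ^ p
    with hg
  set K : Set (F × F) := {x | ‖x.1‖ ^ p + ‖x.2‖ ^ p = 1 ∧ ε ≤ ‖x.1 - x.2‖ ^ p} with hK
  have c1 := hc continuous_fst
  have c2 := hc continuous_snd
  have c3 := hc (continuous_fst.sub continuous_snd)
  have cg : Continuous g := ((c1.add c2).div_const 2).sub (hc (by fun_prop))
  have hKc : IsCompact K := by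
    refine Metric.isCompact_of_isClosed_isBounded ((isClosed_eq (c1.add c2) continuous_const).inter
      (isClosed_le continuous_const c3)) ?_
    refine (Metric.isBounded_closedBall (x := (0 : F × F)) (r := 1)).subset fun x hx => ?_
    have hx1 := hx.1
    have n1 : 0 ≤ ‖x.1‖ ^ p := by positivity
    have n2 : 0 ≤ ‖x.2‖ ^ p := by positivity
    rw [mem_closedBall_zero_iff, Prod.norm_def]
    refine max_le ?_ ?_ <;> rw [← Real.rpow_le_rpow_iff (norm_nonneg _) zero_le_one hp0,
      Real.one_rpow] <;> linarith
  -- The convexity deficit g is positive off the diagonal, and ε keeps the compact set K away from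
  -- the diagonal, so g has a positive minimum on K.
  obtain ⟨δ, hδ, hδg⟩ : ∃ δ : ℝ, 0 < δ ∧ ∀ x ∈ K, δ ≤ g x := by
    rcases K.eq_empty_or_nonempty with hE | hN
    · exact ⟨1, one_pos, by simp [hE]⟩
    · obtain ⟨x, hx, hm⟩ := hKc.exists_isMinOn hN cg.continuousOn
      refine ⟨g x, ?_, fun y hy => hm hy⟩
      have : x.1 ≠ x.2 := by
        intro h
        have := hx.2
        rw [h, sub_self, norm_zero, Real.zero_rpow hp0.ne'] at this
        linarith
      exact sub_pos.2 (norm_midpoint_rpow_lt hp this)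
  -- The factor 2^p comes from |a - b|^p ≤ 2^p (|a|^p + |b|^p), and δ bounds the deficit of a
  -- normalized pair from below.
  refine ⟨2 ^ p / δ, by positivity, fun a b => ?_⟩
  set S := ‖a‖ ^ p + ‖b‖ ^ p with hS
  have hS0 : 0 ≤ S := by positivity
  have hg0 : 0 ≤ S / 2 - ‖(1 / 2 : ℝ) • (a + b)‖ ^ p := sub_nonneg.2 (norm_midpoint_rpow_le hp a b)
  by_cases hcase : ‖a - b‖ ^ p ≤ ε * S
  · have : 0 ≤ 2 ^ p / δ * (S / 2 - ‖(1 / 2 : ℝ) • (a + b)‖ ^ p) := by positivity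
    linarith
  push Not at hcase
  have hSpos : 0 < S := by
    rcases hS0.lt_or_eq with h | h
    · exact h
    · exfalso
      have n1 : 0 ≤ ‖a‖ ^ p := by positivity
      have n2 : 0 ≤ ‖b‖ ^ p := by positivity
      have ha : ‖a‖ ^ p = 0 := by linarith
      have hb : ‖b‖ ^ p = 0 := by linarith
      rw [Real.rpow_eq_zero (norm_nonneg _) hp0.ne', norm_eq_zero] at ha hb
      rw [← h, ha, hb, sub_self, norm_zero, Real.zero_rpow hp0.ne'] at hcase
      simp at hcase
  -- All terms are homogeneous of degree p, so scaling by S^{-1/p} moves the pair into K.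
  set l : ℝ := (S ^ (1 / p))⁻¹ with hl
  have hl0 : 0 < l := by positivity
  have hlp : l ^ p = S⁻¹ := by
    rw [hl, Real.inv_rpow (by positivity), ← Real.rpow_mul hS0, one_div_mul_cancel hp0.ne',
      Real.rpow_one]
  have hsc : ∀ x : F, ‖l • x‖ ^ p = S⁻¹ * ‖x‖ ^ p := fun x => by
    rw [norm_smul, Real.norm_of_nonneg hl0.le, Real.mul_rpow hl0.le (norm_nonneg _), hlp]
  have hmem : ((l • a, l • b) : F × F) ∈ K := by
    refine ⟨?_, ?_⟩
    · simp only [hsc]; rw [← mul_add, ← hS, inv_mul_cancel₀ hSpos.ne']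
    · simp only [← smul_sub, hsc]
      rw [inv_mul_eq_div, le_div_iff₀ hSpos]; exact hcase.le
  have h1 := hδg _ hmem
  have h2 : g (l • a, l • b) = S⁻¹ * (S / 2 - ‖(1 / 2 : ℝ) • (a + b)‖ ^ p) := by
    simp only [hg, ← smul_add, smul_comm _ l, hsc]; ring
  have h3 : ‖a - b‖ ^ p ≤ 2 ^ p * S := by
    have h4 : (1 / 2 : ℝ) • (a + -b) = (1 / 2 : ℝ) • (a - b) := by rw [sub_eq_add_neg]
    have h5 := norm_midpoint_rpow_le hp a (-b)
    rw [h4, norm_neg, ← hS, norm_smul, Real.mul_rpow (norm_nonneg _) (norm_nonneg _)] at h5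
    have h6 : (2 : ℝ) ^ p * ‖(1 / 2 : ℝ)‖ ^ p = 1 := by
      rw [← Real.mul_rpow (by norm_num) (norm_nonneg _)]; norm_num
    calc ‖a - b‖ ^ p = 2 ^ p * (‖(1 / 2 : ℝ)‖ ^ p * ‖a - b‖ ^ p) := by rw [← mul_assoc, h6, one_mul]
      _ ≤ 2 ^ p * S := by gcongr; linarith
  rw [h2, inv_mul_eq_div, le_div_iff₀ hSpos] at h1
  have h7 : 2 ^ p * S ≤ 2 ^ p / δ * (S / 2 - ‖(1 / 2 : ℝ) • (a + b)‖ ^ p) := by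
    rw [div_mul_eq_mul_div, le_div_iff₀ hδ, mul_assoc, mul_comm S]
    gcongr
  have : 0 ≤ ε * S := by positivity
  linarith

end Pointwise

/-! ### Duality and limits in L^p -/

section LpTools

variable {α F : Type*} [MeasurableSpace α] {μ : Measure α} [NormedAddCommGroup F]
  [InnerProductSpace ℝ F] {p : ℝ}

theorem holderConjugate_ofReal (hp : 1 < p) :
    ENNReal.HolderConjugate (ENNReal.ofReal (p / (p - 1))) (ENNReal.ofReal p) :=
  (Real.HolderConjugate.conjExponent hp).symm.ennrealOfReal

theorem memLp_pflux (hp : 1 < p) {G : α → F} (hG : MemLp G (ENNReal.ofReal p) μ) :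
    MemLp (fun x => pflux p (G x)) (ENNReal.ofReal (p / (p - 1))) μ := by
  have h := hG.norm_rpow_div (ENNReal.ofReal (p - 1))
  rw [ENNReal.toReal_ofReal (by linarith), ← ENNReal.ofReal_div_of_pos (by linarith)] at h
  refine h.of_le ((continuous_pflux hp).comp_aestronglyMeasurable hG.1) (Eventually.of_forall
    fun x => ?_)
  rw [norm_pflux hp]
  exact le_abs_self _

theorem memLp_smul_pflux (hp : 1 < p) {σ : α → ℝ} (hσ : MemLp σ ∞ μ) {G : α → F}
    (hG : MemLp G (ENNReal.ofReal p) μ) :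
    MemLp (fun x => σ x • pflux p (G x)) (ENNReal.ofReal (p / (p - 1))) μ :=
  (memLp_pflux hp hG).smul hσ

theorem integrable_inner_of_memLp (hp : 1 < p) {V G : α → F}
    (hV : MemLp V (ENNReal.ofReal (p / (p - 1))) μ) (hG : MemLp G (ENNReal.ofReal p) μ) :
    Integrable (fun x => inner ℝ (V x) (G x)) μ := by
  have := holderConjugate_ofReal hp
  exact memLp_one_iff_integrable.1 ((innerSL ℝ).memLp_of_bilin 1 hV hG)

/-- An `L^{p'}` field acts continuously on `L^p`. -/
theorem exists_clm_integral_inner [hp : Fact (1 < p)] {V : α → F}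
    (hV : MemLp V (ENNReal.ofReal (p / (p - 1))) μ) :
    ∃ L : Lp F (ENNReal.ofReal p) μ →L[ℝ] ℝ, ∀ u, L u = ∫ x, inner ℝ (V x) (u x) ∂μ := by
  have := holderConjugate_ofReal hp.out
  have : Fact (1 ≤ ENNReal.ofReal (p / (p - 1))) := ⟨by
    have : 1 < p := hp.out
    rw [← ENNReal.ofReal_one]
    refine ENNReal.ofReal_le_ofReal ?_
    rw [le_div_iff₀ (by linarith)]; linarith⟩
  refine ⟨(innerSL ℝ).lpPairing μ (ENNReal.ofReal (p / (p - 1))) (ENNReal.ofReal p) (hV.toLp V),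
    fun u => ?_⟩
  rw [ContinuousLinearMap.lpPairing_eq_integral]
  refine integral_congr_ae ?_
  filter_upwards [hV.coeFn_toLp] with x hx
  rw [hx, innerSL_apply_apply]

theorem integrable_norm_rpow_of_memLp {F : Type*} [NormedAddCommGroup F] (hp : 1 < p) {G : α → F}
    (hG : MemLp G (ENNReal.ofReal p) μ) : Integrable (fun x => ‖G x‖ ^ p) μ := by
  have h := hG.integrable_norm_rpow (by simpa using by linarith) ENNReal.ofReal_ne_top
  rwa [ENNReal.toReal_ofReal (by linarith)] at h

theorem integrable_mul_of_memLp_top {σ f : α → ℝ} (hσ : MemLp σ ∞ μ) (hf : Integrable f μ) :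
    Integrable (fun x => σ x * f x) μ :=
  memLp_one_iff_integrable.1 ((memLp_one_iff_integrable.2 hf).smul hσ)

/-- Dominated convergence: for 0 < t < 1 the integrand is bounded by |σ|(|G| + |H|)^p. -/
theorem tendsto_integral_pflux {σ : α → ℝ} (hp1 : 1 < p) (hσ : MemLp σ ∞ μ) {G H : α → F}
    (hG : MemLp G (ENNReal.ofReal p) μ) (hH : MemLp H (ENNReal.ofReal p) μ) :
    Tendsto (fun t : ℝ => ∫ x, σ x * inner ℝ (pflux p (G x + t • H x)) (H x) ∂μ) (𝓝[>] 0)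
      (𝓝 (∫ x, σ x * inner ℝ (pflux p (G x)) (H x) ∂μ)) := by
  set g : ℝ → α → ℝ := fun t x =>
    σ x * inner ℝ (pflux p (G x + t • H x)) (H x) with hg
  have hmeas : ∀ t, AEStronglyMeasurable (g t) μ := fun t =>
    hσ.1.mul (((continuous_pflux hp1).comp_aestronglyMeasurable
      (hG.1.add (hH.1.const_smul t))).inner hH.1)
  set b : α → ℝ := fun x => ‖G x‖ + ‖H x‖ with hb
  have hbL : MemLp b (ENNReal.ofReal p) μ :=
    hG.norm.add hH.norm
  have hint : Integrable (fun x => ‖σ x‖ * b x ^ p) μ := by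
    refine integrable_mul_of_memLp_top hσ.norm ?_
    refine (integrable_norm_rpow_of_memLp hp1 hbL).congr (Eventually.of_forall fun x => ?_)
    simp only [hb]
    rw [Real.norm_of_nonneg (by positivity)]
  have hlim : Tendsto (fun t => ∫ x, g t x ∂μ) (𝓝[>] 0) (𝓝 (∫ x, g 0 x ∂μ)) := by
    refine tendsto_integral_filter_of_dominated_convergence (fun x => ‖σ x‖ * b x ^ p)
      (Eventually.of_forall hmeas) ?_ hint (Eventually.of_forall fun x => ?_)
    · have : Ioo (0 : ℝ) 1 ∈ 𝓝[>] (0 : ℝ) := Ioo_mem_nhdsGT one_pos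
      filter_upwards [this] with t ht
      refine Eventually.of_forall fun x => ?_
      have hb0 : 0 ≤ b x := by positivity
      have h1 : ‖G x + t • H x‖ ≤ b x := by
        refine (norm_add_le _ _).trans ?_
        rw [norm_smul, Real.norm_of_nonneg ht.1.le]
        have := mul_le_of_le_one_left (norm_nonneg (H x)) ht.2.le
        simp only [hb]; linarith
      have h2 : ‖H x‖ ≤ b x := by simp only [hb]; linarith [norm_nonneg (G x)]
      rw [hg, norm_mul]
      gcongr
      calc ‖inner ℝ (pflux p (G x + t • H x)) (H x)‖
          ≤ ‖pflux p (G x + t • H x)‖ * ‖H x‖ := norm_inner_le_norm _ _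
        _ ≤ b x ^ (p - 1) * b x := by
          rw [norm_pflux hp1]
          gcongr
        _ = b x ^ p := by
          rw [← Real.rpow_add_one' hb0 (by linarith)]; congr 1; ring
    · have hc : Continuous fun t => g t x := by
        refine continuous_const.mul (((continuous_pflux hp1).comp ?_).inner continuous_const)
        fun_prop
      exact (hc.tendsto 0).mono_left nhdsWithin_le_nhds
  simpa [hg] using hlim

theorem Lp_norm_rpow {F : Type*} [NormedAddCommGroup F] [hp : Fact (1 < p)]
    (f : Lp F (ENNReal.ofReal p) μ) :
    ‖f‖ ^ p = ∫ x, ‖f x‖ ^ p ∂μ := by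
  have hp0 : 0 < p := by linarith [hp.out]
  have h0 : 0 ≤ ∫ x, ‖f x‖ ^ p ∂μ := integral_nonneg fun x => by positivity
  rw [Lp.norm_def, (Lp.memLp f).eLpNorm_eq_integral_rpow_norm (by simpa using hp0)
    ENNReal.ofReal_ne_top, ENNReal.toReal_ofReal hp0.le, ENNReal.toReal_ofReal (by positivity),
    Real.rpow_inv_rpow h0 hp0.ne']

end LpTools

/-! ### Convexity of the energy and its Euler–Lagrange equation -/

section Weak

variable {n : ℕ} {p : ℝ} [hp : Fact (1 < p)] {Ω : Set (E n)}

theorem memLp_grad (u : W1p p Ω) : MemLp (grad u) (ENNReal.ofReal p) (volume.restrict Ω) :=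
  Lp.memLp u.1.2

theorem grad_add (u v : W1p p Ω) :
    grad (u + v) =ᵐ[volume.restrict Ω] fun x => grad u x + grad v x :=
  Lp.coeFn_add u.1.2 v.1.2

theorem grad_sub (u v : W1p p Ω) :
    grad (u - v) =ᵐ[volume.restrict Ω] fun x => grad u x - grad v x :=
  Lp.coeFn_sub u.1.2 v.1.2

theorem grad_smul (c : ℝ) (u : W1p p Ω) :
    grad (c • u) =ᵐ[volume.restrict Ω] fun x => c • grad u x :=
  Lp.coeFn_smul c u.1.2

theorem integrable_energy {σ : E n → ℝ} (hσ : MemLp σ ∞ (volume.restrict Ω)) (u : W1p p Ω) :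
    IntegrableOn (fun x => σ x * ‖grad u x‖ ^ p) Ω :=
  integrable_mul_of_memLp_top hσ (integrable_norm_rpow_of_memLp hp.out (memLp_grad u))

/-- The weak form `(u, w) ↦ ∫ σ |∇u|^{p-2} ∇u · ∇w`. -/
noncomputable def weakForm (σ : E n → ℝ) (u w : W1p p Ω) : ℝ :=
  ∫ x in Ω, σ x * inner ℝ (pflux p (grad u x)) (grad w x)

theorem integrable_weakForm {σ : E n → ℝ} (hσ : MemLp σ ∞ (volume.restrict Ω)) (u w : W1p p Ω) :
    IntegrableOn (fun x => σ x * inner ℝ (pflux p (grad u x)) (grad w x)) Ω :=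
  integrable_mul_of_memLp_top hσ
    (integrable_inner_of_memLp hp.out (memLp_pflux hp.out (memLp_grad u)) (memLp_grad w))

/-- Continuity in the second argument lets identities pass from test functions to their closure and
to limits of minimizing sequences. -/
theorem exists_clm_weakForm {σ : E n → ℝ} (hσ : MemLp σ ∞ (volume.restrict Ω)) (u : W1p p Ω) :
    ∃ L : W1p p Ω →L[ℝ] ℝ, ∀ w, L w = weakForm σ u w := by
  obtain ⟨L, hL⟩ := exists_clm_integral_inner (p := p)
    (memLp_smul_pflux hp.out hσ (memLp_grad u))
  refine ⟨L.comp ((ContinuousLinearMap.snd ℝ _ _).comp (W1p p Ω).subtypeL), fun w => ?_⟩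
  change L w.1.2 = _
  rw [hL, weakForm]
  simp only [real_inner_smul_left]
  rfl

theorem weakForm_self {σ : E n → ℝ} (u : W1p p Ω) : weakForm σ u u = energy σ u := by
  simp only [weakForm, energy, inner_pflux_self hp.out]

theorem weakForm_sub {σ : E n → ℝ} (hσ : MemLp σ ∞ (volume.restrict Ω)) (u v w : W1p p Ω) :
    weakForm σ u (v - w) = weakForm σ u v - weakForm σ u w := by
  obtain ⟨L, hL⟩ := exists_clm_weakForm hσ u
  rw [← hL, ← hL, ← hL, map_sub]

theorem weakForm_smul {σ : E n → ℝ} (u : W1p p Ω) (c : ℝ) (w : W1p p Ω) :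
    weakForm σ u (c • w) = c * weakForm σ u w := by
  rw [weakForm, weakForm, ← integral_const_mul]
  refine integral_congr_ae ?_
  filter_upwards [grad_smul c w] with x hx
  rw [hx, real_inner_smul_right]
  ring

theorem energy_tangent {σ : E n → ℝ} (hσ : MemLp σ ∞ (volume.restrict Ω))
    (h0 : ∀ᵐ x ∂(volume.restrict Ω), 0 ≤ σ x) (u v : W1p p Ω) :
    energy σ u + p * weakForm σ u (v - u) ≤ energy σ v := by
  have i1 := integrable_energy hσ u
  have i2 := (integrable_weakForm hσ u (v - u)).const_mul p
  rw [weakForm, energy, energy, ← integral_const_mul, ← integral_add i1 i2]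
  refine integral_mono_ae (i1.add i2) (integrable_energy hσ v) ?_
  filter_upwards [grad_sub v u, h0] with x hx h0x
  rw [hx]
  have := mul_le_mul_of_nonneg_left (norm_rpow_tangent hp.out (grad v x) (grad u x)) h0x
  linarith

theorem mkQ_eq_iff {u v : W1p p Ω} : (W1p0 p Ω).mkQ u = (W1p0 p Ω).mkQ v ↔ u - v ∈ W1p0 p Ω := by
  rw [Submodule.mkQ_apply, Submodule.mkQ_apply, Submodule.Quotient.eq]

theorem isMinimizer_of_weak {σ : E n → ℝ} (hσ : MemLp σ ∞ (volume.restrict Ω))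
    (h0 : ∀ᵐ x ∂(volume.restrict Ω), 0 ≤ σ x) {u : W1p p Ω}
    (hu : ∀ w ∈ W1p0 p Ω, weakForm σ u w = 0) : IsMinimizer σ ((W1p0 p Ω).mkQ u) u := by
  refine ⟨rfl, fun v hv => ?_⟩
  have h := energy_tangent hσ h0 u v
  rw [hu _ (mkQ_eq_iff.1 hv)] at h
  linarith

/-- The energy is never differentiated. The tangent inequality based at u + tw, compared with the
minimality of u, gives a nonnegative weak form at u + tw in the direction w. Then t → 0, and the
argument is repeated for -w. -/
theorem weak_eq_zero_of_isMinimizer {σ : E n → ℝ} (hσ : MemLp σ ∞ (volume.restrict Ω))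
    (h0 : ∀ᵐ x ∂(volume.restrict Ω), 0 ≤ σ x) {f : BdryVal p Ω} {u : W1p p Ω}
    (hu : IsMinimizer σ f u) {w : W1p p Ω} (hw : w ∈ W1p0 p Ω) : weakForm σ u w = 0 := by
  have hp1 : 1 < p := hp.out
  have key : ∀ w ∈ W1p0 p Ω, 0 ≤ weakForm σ u w := by
    intro w hw
    have step : ∀ t : ℝ, 0 < t → 0 ≤ weakForm σ (u + t • w) w := by
      intro t ht
      have h1 := hu.2 (u + t • w) (by
        rw [← hu.1, mkQ_eq_iff, add_sub_cancel_left]; exact Submodule.smul_mem _ _ hw)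
      have h2 := energy_tangent hσ h0 (u + t • w) u
      have h3 : u - (u + t • w) = (-t) • w := by module
      rw [h3, weakForm_smul] at h2
      have h4 : 0 ≤ p * t * weakForm σ (u + t • w) w := by linarith
      exact nonneg_of_mul_nonneg_right h4 (by positivity)
    have hlim := tendsto_integral_pflux hp1 hσ (memLp_grad u) (memLp_grad w)
    refine ge_of_tendsto hlim ?_
    filter_upwards [self_mem_nhdsWithin] with t ht
    refine (step t ht).trans_eq (integral_congr_ae ?_)
    filter_upwards [grad_add u (t • w), grad_smul t w] with x h1 h2
    rw [h1, h2]
  have h1 := key w hw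
  have h2 := key ((-1 : ℝ) • w) (Submodule.smul_mem _ _ hw)
  rw [weakForm_smul] at h2
  linarith

/-- Quantitative strict convexity of the energy. -/
theorem energy_sub_le {ε : ℝ} (hε : 0 < ε) :
    ∃ C : ℝ, 0 ≤ C ∧ ∀ σ : E n → ℝ, MemLp σ ∞ (volume.restrict Ω) →
      (∀ᵐ x ∂(volume.restrict Ω), 0 ≤ σ x) → ∀ u v : W1p p Ω,
      energy σ (u - v) ≤ ε * (energy σ u + energy σ v) +
        C * ((energy σ u + energy σ v) / 2 - energy σ ((1 / 2 : ℝ) • (u + v))) := by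
  obtain ⟨C, hC0, hC⟩ := norm_sub_rpow_le (F := E n) hp.out hε
  refine ⟨C, hC0, fun σ hσ h0 u v => ?_⟩
  have i1 := integrable_energy hσ u
  have i2 := integrable_energy hσ v
  have i3 := integrable_energy hσ ((1 / 2 : ℝ) • (u + v))
  have e : ε * (energy σ u + energy σ v) +
        C * ((energy σ u + energy σ v) / 2 - energy σ ((1 / 2 : ℝ) • (u + v))) =
      ∫ x in Ω, (ε * (σ x * ‖grad u x‖ ^ p + σ x * ‖grad v x‖ ^ p) +
        C * ((σ x * ‖grad u x‖ ^ p + σ x * ‖grad v x‖ ^ p) / 2 -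
          σ x * ‖grad ((1 / 2 : ℝ) • (u + v)) x‖ ^ p)) := by
    have e1 := integral_add i1 i2
    have e2 := integral_sub ((i1.add i2).div_const 2) i3
    have e3 := integral_add ((i1.add i2).const_mul ε)
      ((((i1.add i2).div_const 2).sub i3).const_mul C)
    simp only [Pi.add_apply, Pi.sub_apply, integral_const_mul, integral_div] at e1 e2 e3
    rw [e3, e2, e1]
    rfl
  rw [e]
  refine integral_mono_ae (integrable_energy hσ (u - v))
    (((i1.add i2).const_mul ε).add ((((i1.add i2).div_const 2).sub i3).const_mul C)) ?_
  filter_upwards [h0, grad_sub u v, grad_add u v, grad_smul (1 / 2) (u + v)] with x h0x h1 h2 h3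
  rw [h1, h3, h2]
  have := mul_le_mul_of_nonneg_left (hC (grad u x) (grad v x)) h0x
  linarith

theorem energy_nonneg {σ : E n → ℝ} (h0 : ∀ᵐ x ∂(volume.restrict Ω), 0 ≤ σ x) (u : W1p p Ω) :
    0 ≤ energy σ u := by
  refine integral_nonneg_of_ae ?_
  filter_upwards [h0] with x hx
  exact mul_nonneg hx (by positivity)

theorem mkQ_midpoint {f : BdryVal p Ω} {u v : W1p p Ω} (hu : (W1p0 p Ω).mkQ u = f)
    (hv : (W1p0 p Ω).mkQ v = f) : (W1p0 p Ω).mkQ ((1 / 2 : ℝ) • (u + v)) = f := by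
  have h : (1 / 2 : ℝ) • (u + v) - v = (1 / 2 : ℝ) • (u - v) := by module
  rw [← hv, mkQ_eq_iff, h]
  exact Submodule.smul_mem _ _ (mkQ_eq_iff.1 (hu.trans hv.symm))

theorem le_energy {σ : E n → ℝ} (hσ : MemLp σ ∞ (volume.restrict Ω)) {c : ℝ}
    (hc : ∀ᵐ x ∂(volume.restrict Ω), c ≤ σ x) (u : W1p p Ω) :
    c * ‖u.1.2‖ ^ p ≤ energy σ u := by
  rw [Lp_norm_rpow, ← integral_const_mul]
  refine integral_mono_ae ((integrable_norm_rpow_of_memLp hp.out (memLp_grad u)).const_mul c)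
    (integrable_energy hσ u) ?_
  filter_upwards [hc] with x hx
  exact mul_le_mul_of_nonneg_right hx (by positivity)

theorem IsConductivity.nonneg {σ : E n → ℝ} (hσ : IsConductivity Ω σ) :
    ∀ᵐ x ∂(volume.restrict Ω), 0 ≤ σ x := by
  obtain ⟨c, hc, h⟩ := hσ.2
  filter_upwards [h] with x hx using hc.le.trans hx

/-- The gradients of two minimizers coincide. -/
theorem IsMinimizer.grad_eq {σ : E n → ℝ} (hσ : IsConductivity Ω σ) {f : BdryVal p Ω}
    {u v : W1p p Ω} (hu : IsMinimizer σ f u) (hv : IsMinimizer σ f v) :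
    grad u =ᵐ[volume.restrict Ω] grad v := by
  have hp0 : 0 < p := by linarith [hp.out]
  have huv : energy σ u = energy σ v := le_antisymm (hu.2 v hv.1) (hv.2 u hu.1)
  have hmid := hu.2 _ (mkQ_midpoint hu.1 hv.1)
  -- The midpoint is admissible, so the convexity deficit is at most 0 and only the ε term survives.
  have hle : ∀ ε : ℝ, 0 < ε → energy σ (u - v) ≤ ε * (energy σ u + energy σ v) := by
    intro ε hε
    obtain ⟨C, hC0, hC⟩ := energy_sub_le (n := n) (p := p) (Ω := Ω) hε
    have h := hC σ hσ.1 hσ.nonneg u v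
    have : C * ((energy σ u + energy σ v) / 2 - energy σ ((1 / 2 : ℝ) • (u + v))) ≤ 0 :=
      mul_nonpos_of_nonneg_of_nonpos hC0 (by linarith)
    linarith
  have hz : energy σ (u - v) ≤ 0 := by
    have hS : 0 ≤ energy σ u + energy σ v :=
      add_nonneg (energy_nonneg hσ.nonneg u) (energy_nonneg hσ.nonneg v)
    refine le_of_forall_pos_le_add fun δ hδ => ?_
    have h := hle (δ / (energy σ u + energy σ v + 1)) (by positivity)
    have : δ / (energy σ u + energy σ v + 1) * (energy σ u + energy σ v) ≤ δ := by
      rw [div_mul_eq_mul_div, div_le_iff₀ (by positivity)]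
      nlinarith
    linarith
  obtain ⟨c, hc, hcσ⟩ := hσ.2
  have h1 := (le_energy hσ.1 hcσ (u - v)).trans hz
  have h2 : ‖(u - v).1.2‖ ^ p = 0 :=
    le_antisymm (nonpos_of_mul_nonpos_right h1 hc) (by positivity)
  rw [Real.rpow_eq_zero (norm_nonneg _) hp0.ne', norm_eq_zero] at h2
  have h3 : u.1.2 = v.1.2 := sub_eq_zero.1 h2
  unfold grad
  rw [h3]

end Weak

/-! ### Completeness of the Sobolev space and uniqueness of weak gradients -/

section Complete

variable {n : ℕ} {p : ℝ} [hp : Fact (1 < p)] {Ω : Set (E n)}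

theorem isClosed_W1p : IsClosed (W1p p Ω : Set (Lp ℝ (ENNReal.ofReal p) (volume.restrict Ω) ×
    Lp (E n) (ENNReal.ofReal p) (volume.restrict Ω))) := by
  have hset : (W1p p Ω : Set (Lp ℝ (ENNReal.ofReal p) (volume.restrict Ω) ×
      Lp (E n) (ENNReal.ofReal p) (volume.restrict Ω))) =
      ⋂ (φ : E n → ℝ) (_ : IsTest Ω φ) (v : E n), {w | ∫ x in Ω, w.1 x * fderiv ℝ φ x v =
        - ∫ x in Ω, φ x * inner ℝ (w.2 x) v} := by
    ext w
    simp only [mem_iInter, mem_ofPred_eq]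
    rfl
  rw [hset]
  refine isClosed_iInter fun φ => isClosed_iInter fun hφ => isClosed_iInter fun v => ?_
  have hc1 : Continuous fun x => fderiv ℝ φ x v :=
    (hφ.1.continuous_fderiv (by simp)).clm_apply continuous_const
  have hc2 : Continuous fun x => φ x • v := hφ.1.continuous.smul continuous_const
  have m1 : MemLp (fun x => fderiv ℝ φ x v) (ENNReal.ofReal (p / (p - 1)))
      (volume.restrict Ω) :=
    hc1.memLp_of_hasCompactSupport (hφ.2.1.fderiv_apply (𝕜 := ℝ) v)
  have m2 : MemLp (fun x => φ x • v) (ENNReal.ofReal (p / (p - 1))) (volume.restrict Ω) :=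
    hc2.memLp_of_hasCompactSupport hφ.2.1.smul_right
  obtain ⟨L1, h1⟩ := exists_clm_integral_inner (p := p) m1
  obtain ⟨L2, h2⟩ := exists_clm_integral_inner (p := p) m2
  have e : {w : Lp ℝ (ENNReal.ofReal p) (volume.restrict Ω) ×
      Lp (E n) (ENNReal.ofReal p) (volume.restrict Ω) | ∫ x in Ω, w.1 x * fderiv ℝ φ x v =
        - ∫ x in Ω, φ x * inner ℝ (w.2 x) v} = {w | L1 w.1 = - L2 w.2} := by
    ext w
    simp only [mem_ofPred_eq, h1, h2, real_inner_smul_left, real_inner_comm v]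
    rfl
  rw [e]
  exact isClosed_eq (L1.continuous.comp continuous_fst) (L2.continuous.comp continuous_snd).neg

instance : CompleteSpace (W1p p Ω) := (isClosed_W1p (p := p) (Ω := Ω)).completeSpace_coe

/-- The fundamental lemma of the calculus of variations, applied to each component of G - H. -/
theorem IsWeakGrad.ae_eq (hΩ : IsOpen Ω) {u v : E n → ℝ} {G H : E n → E n}
    (huv : u =ᵐ[volume.restrict Ω] v)
    (hu : IsWeakGrad Ω u G) (hv : IsWeakGrad Ω v H) (hG : MemLp G (ENNReal.ofReal p)
    (volume.restrict Ω)) (hH : MemLp H (ENNReal.ofReal p) (volume.restrict Ω)) :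
    G =ᵐ[volume.restrict Ω] H := by
  have key : ∀ w : E n, ∀ᵐ x ∂(volume.restrict Ω), inner ℝ (G x - H x) w = 0 := by
    intro w
    rw [ae_restrict_iff' hΩ.measurableSet]
    refine hΩ.ae_eq_zero_of_integral_contDiff_smul_eq_zero ?_ ?_
    · exact locallyIntegrableOn_of_locallyIntegrable_restrict
        (((hG.sub hH).inner_const w).locallyIntegrable Fact.out)
    · intro g hg1 hg2 hg3
      have ht : IsTest Ω g := ⟨hg1, hg2, hg3⟩
      have e : ∫ x, g x • inner ℝ (G x - H x) w = ∫ x in Ω, g x • inner ℝ (G x - H x) w := by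
        refine (setIntegral_eq_integral_of_forall_compl_eq_zero fun x hx => ?_).symm
        rw [image_eq_zero_of_notMem_tsupport fun h => hx (hg3 h), zero_smul]
      rw [e]
      simp only [inner_sub_left, smul_eq_mul, mul_sub]
      rw [integral_sub (ht.integrable_right p Ω hG w) (ht.integrable_right p Ω hH w)]
      have h1 := hu g ht w
      have h2 := hv g ht w
      have h3 : ∫ x in Ω, u x * fderiv ℝ g x w = ∫ x in Ω, v x * fderiv ℝ g x w := by
        refine integral_congr_ae ?_
        filter_upwards [huv] with x hx
        rw [hx]
      linarith
  have hall : ∀ᵐ x ∂(volume.restrict Ω), ∀ i : Fin n,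
      inner ℝ (G x - H x) (EuclideanSpace.single i (1 : ℝ)) = 0 := ae_all_iff.2 fun i => key _
  filter_upwards [hall] with x hx
  rw [← sub_eq_zero]
  ext i
  have h := hx i
  rw [EuclideanSpace.inner_single_right] at h
  simpa using h

end Complete

/-! ### Integration by parts and the Poincaré inequality -/

section ByParts

variable {n : ℕ} {Ω : Set (E n)}

theorem integral_mul_fderiv_of_compactSupport {f g : E n → ℝ} (hf : ContDiff ℝ 1 f)
    (hg : ContDiff ℝ 1 g) (hgc : HasCompactSupport g) (v : E n) :
    ∫ x, f x * fderiv ℝ g x v = - ∫ x, fderiv ℝ f x v * g x := by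
  have c1 : Continuous fun x => fderiv ℝ f x v :=
    (hf.continuous_fderiv (by simp)).clm_apply continuous_const
  have c2 : Continuous fun x => fderiv ℝ g x v :=
    (hg.continuous_fderiv (by simp)).clm_apply continuous_const
  refine integral_mul_fderiv_eq_neg_fderiv_mul_of_integrable
    ((c1.mul hg.continuous).integrable_of_hasCompactSupport hgc.mul_left)
    ((hf.continuous.mul c2).integrable_of_hasCompactSupport (hgc.fderiv_apply (𝕜 := ℝ) v).mul_left)
    ((hf.continuous.mul hg.continuous).integrable_of_hasCompactSupport hgc.mul_left)
    (fun x _ => hf.differentiable (by simp) x) (fun x _ => hg.differentiable (by simp) x)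

theorem IsTest.setIntegral_mul_fderiv {φ : E n → ℝ} (hφ : IsTest Ω φ) {f : E n → ℝ}
    (hf : ContDiff ℝ 1 f) (v : E n) :
    ∫ x in Ω, f x * fderiv ℝ φ x v = - ∫ x in Ω, fderiv ℝ f x v * φ x := by
  rw [setIntegral_eq_integral_of_forall_compl_eq_zero,
    setIntegral_eq_integral_of_forall_compl_eq_zero]
  · exact integral_mul_fderiv_of_compactSupport hf (hφ.1.of_le (by simp)) hφ.2.1 v
  · intro x hx
    rw [image_eq_zero_of_notMem_tsupport fun h => hx (hφ.2.2 h), mul_zero]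
  · intro x hx
    have : fderiv ℝ φ x = 0 :=
      image_eq_zero_of_notMem_tsupport fun h => hx (hφ.2.2 (tsupport_fderiv_subset ℝ h))
    rw [this]; simp

theorem continuous_gradient {u : E n → ℝ} (hu : ContDiff ℝ 1 u) : Continuous (gradient u) :=
  (InnerProductSpace.toDual ℝ (E n)).symm.continuous.comp (hu.continuous_fderiv (by simp))

theorem isWeakGrad_gradient {u : E n → ℝ} (hu : ContDiff ℝ 1 u) :
    IsWeakGrad Ω u (gradient u) := by
  intro φ hφ v
  rw [hφ.setIntegral_mul_fderiv hu v]
  congr 1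
  refine integral_congr_ae (Eventually.of_forall fun x => ?_)
  simp only
  rw [gradient, InnerProductSpace.toDual_symm_apply, mul_comm]

/-- A Poincaré inequality for compactly supported functions. -/
theorem integral_norm_rpow_le {p : ℝ} (hp : 1 < p) {e : E n} (he : ‖e‖ = 1) {R : ℝ} {φ : E n → ℝ}
    (hφ : ContDiff ℝ 1 φ) (hc : HasCompactSupport φ) (hR : ∀ x, φ x ≠ 0 → ‖x‖ ≤ R) :
    ∫ x, ‖φ x‖ ^ p ≤ 2 * ((2 * (p - 1)) ^ (p - 1) * R ^ p) * ∫ x, ‖gradient φ x‖ ^ p := by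
  have hp0 : 0 < p := by linarith
  have hp1 : 0 < p - 1 := by linarith
  have cg : Continuous (gradient φ) := continuous_gradient hφ
  have hgc : HasCompactSupport (gradient φ) :=
    (hc.fderiv (𝕜 := ℝ)).comp_left (g := (InnerProductSpace.toDual ℝ (E n)).symm) (map_zero _)
  have i1 : Integrable fun x => ‖φ x‖ ^ p :=
    (hφ.continuous.norm.rpow_const fun _ => Or.inr hp0.le).integrable_of_hasCompactSupport
      (hc.comp_left (g := fun y => ‖y‖ ^ p) (by simp [hp0.ne']))
  have i2 : Integrable fun x => ‖gradient φ x‖ ^ p :=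
    (cg.norm.rpow_const fun _ => Or.inr hp0.le).integrable_of_hasCompactSupport
      (hgc.comp_left (g := fun y => ‖y‖ ^ p) (by simp [hp0.ne']))
  have hF : ContDiff ℝ 1 fun x => ‖φ x‖ ^ p := hφ.norm_rpow hp
  have hFc : HasCompactSupport fun x => ‖φ x‖ ^ p :=
    hc.comp_left (g := fun y => ‖y‖ ^ p) (by simp [hp0.ne'])
  -- The function x·e has derivative 1 along e, so integrating by parts against it turns ∫ |φ|^p
  -- into -∫ (x·e) ∂_e |φ|^p.
  have hl : ContDiff ℝ 1 fun x : E n => inner ℝ e x := contDiff_const.inner ℝ contDiff_id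
  have hld : ∀ x : E n, fderiv ℝ (fun x : E n => inner ℝ e x) x e = 1 := by
    intro x
    rw [show (fun x : E n => inner ℝ e x) = innerSL ℝ e from rfl, ContinuousLinearMap.fderiv,
      innerSL_apply_apply, real_inner_self_eq_norm_sq, he, one_pow]
  have hFd : ∀ x, fderiv ℝ (fun x => ‖φ x‖ ^ p) x e =
      p * inner ℝ (pflux p (φ x)) (fderiv ℝ φ x e) := by
    intro x
    have h := (hasFDerivAt_norm_rpow (φ x) hp).comp x (hφ.differentiable (by simp) x).hasFDerivAt
    rw [show (fun x => ‖φ x‖ ^ p) = (fun y : ℝ => ‖y‖ ^ p) ∘ φ from rfl, h.fderiv]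
    rw [pflux, real_inner_smul_left, ← mul_assoc]
    rfl
  have hibp := integral_mul_fderiv_of_compactSupport hl hF hFc e
  simp only [hld, one_mul, hFd] at hibp
  -- This weight gives |φ|^p the coefficient 1/2 in Young's inequality, so that term can be absorbed
  -- on the left.
  set s : ℝ := (2 * (p - 1)) ^ (p - 1) with hs
  have hs0 : 0 < s := by positivity
  have hsp : (p - 1) * s ^ (-1 / (p - 1)) = 1 / 2 := by
    rw [hs, ← Real.rpow_mul (by positivity), mul_div_cancel₀ _ hp1.ne', Real.rpow_neg_one]
    field_simp
  have hpt : ∀ x, -(inner ℝ e x * (p * inner ℝ (pflux p (φ x)) (fderiv ℝ φ x e))) ≤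
      s * R ^ p * ‖gradient φ x‖ ^ p + 1 / 2 * ‖φ x‖ ^ p := by
    intro x
    by_cases h0 : φ x = 0
    · have : 0 ≤ ‖gradient φ x‖ ^ p := by positivity
      -- R may be negative when φ vanishes identically; a nonzero gradient excludes this.
      have hR0 : 0 ≤ R ^ p * ‖gradient φ x‖ ^ p := by
        by_cases hg0 : gradient φ x = 0
        · simp [hg0, hp0.ne']
        · have : x ∈ tsupport φ := by
            by_contra h
            apply hg0
            have : fderiv ℝ φ x = 0 :=
              image_eq_zero_of_notMem_tsupport fun h' => h (tsupport_fderiv_subset ℝ h')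
            rw [gradient, this, map_zero]
          obtain ⟨y, hy⟩ : (Function.support φ).Nonempty := by
            by_contra h
            rw [not_nonempty_iff_eq_empty] at h
            simp [tsupport, h] at this
          have : 0 ≤ R := (norm_nonneg _).trans (hR y hy)
          positivity
      have hz : pflux p (φ x) = 0 := by rw [h0]; simp [pflux]
      rw [hz, h0]
      simp only [inner_zero_left, mul_zero, neg_zero, norm_zero, Real.zero_rpow hp0.ne', add_zero]
      rw [mul_assoc]; positivity
    · have hRx := hR x h0
      have h := inner_pflux_le hp hs0 (-(inner ℝ e x * fderiv ℝ φ x e)) (φ x)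
      rw [hsp] at h
      have h1 : ‖-(inner ℝ e x * fderiv ℝ φ x e)‖ ≤ R * ‖gradient φ x‖ := by
        rw [norm_neg, norm_mul]
        have a1 : ‖(inner ℝ e x : ℝ)‖ ≤ R := by
          refine (norm_inner_le_norm e x).trans ?_
          rw [he, one_mul]; exact hRx
        have a2 : ‖fderiv ℝ φ x e‖ ≤ ‖gradient φ x‖ := by
          have : fderiv ℝ φ x e = inner ℝ (gradient φ x) e := by
            rw [gradient, InnerProductSpace.toDual_symm_apply]
          rw [this]
          refine (norm_inner_le_norm _ e).trans ?_
          rw [he, mul_one]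
        gcongr
        exact (norm_nonneg _).trans a1
      have hR0 : 0 ≤ R := (norm_nonneg _).trans hRx
      have h2 := Real.rpow_le_rpow (norm_nonneg _) h1 hp0.le
      rw [Real.mul_rpow hR0 (norm_nonneg _)] at h2
      have h3 := mul_le_mul_of_nonneg_left h2 hs0.le
      have h4 : p * inner ℝ (pflux p (φ x)) (-(inner ℝ e x * fderiv ℝ φ x e)) =
          -(inner ℝ e x * (p * inner ℝ (pflux p (φ x)) (fderiv ℝ φ x e))) := by
        rw [inner_neg_right, ← smul_eq_mul (inner ℝ e x), real_inner_smul_right]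
        ring
      rw [← h4]
      linarith
  have i3 : Integrable fun x => s * R ^ p * ‖gradient φ x‖ ^ p + 1 / 2 * ‖φ x‖ ^ p :=
    (i2.const_mul _).add (i1.const_mul _)
  have i4 : Integrable fun x =>
      -(inner ℝ e x * (p * inner ℝ (pflux p (φ x)) (fderiv ℝ φ x e))) := by
    refine Continuous.integrable_of_hasCompactSupport ?_ ?_
    · exact (hl.continuous.mul (continuous_const.mul
        (((continuous_pflux hp).comp hφ.continuous).inner
          ((hφ.continuous_fderiv (by simp)).clm_apply continuous_const)))).neg
    · have : HasCompactSupport fun x => inner ℝ (pflux p (φ x)) (fderiv ℝ φ x e) := by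
        refine hc.mono fun x hx => ?_
        contrapose! hx
        simp only [Function.mem_support, not_not] at hx ⊢
        rw [hx]; simp [pflux]
      exact (this.mul_left.mul_left).neg
  have hle := integral_mono i4 i3 hpt
  rw [integral_neg, integral_add (i2.const_mul _) (i1.const_mul _), integral_const_mul,
    integral_const_mul] at hle
  linarith

end ByParts

/-! ### Existence of minimizers by the direct method -/

section Existence

variable {n : ℕ} {p : ℝ} [hp : Fact (1 < p)] {Ω : Set (E n)}

theorem memLp_of_continuous_bounded (hΩ : Bornology.IsBounded Ω) {F : Type*} [NormedAddCommGroup F]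
    {g : E n → F} (hg : Continuous g) (q : ℝ≥0∞) : MemLp g q (volume.restrict Ω) := by
  have hK : IsCompact (closure Ω) := hΩ.isCompact_closure
  have : IsFiniteMeasure (volume.restrict (closure Ω)) :=
    isFiniteMeasure_restrict.2 hK.measure_ne_top
  obtain ⟨C, hC⟩ := hK.exists_bound_of_continuousOn hg.continuousOn
  have h : MemLp g q (volume.restrict (closure Ω)) := by
    refine MemLp.of_bound hg.aestronglyMeasurable C ?_
    exact (ae_restrict_iff' isClosed_closure.measurableSet).2 (Eventually.of_forall hC)
  exact h.mono_measure (Measure.restrict_mono subset_closure le_rfl)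

theorem grad_eq_gradient_of_isTest (hΩo : IsOpen Ω) (hΩb : Bornology.IsBounded Ω) {w : W1p p Ω}
    {φ : E n → ℝ} (hφ : IsTest Ω φ) (hwφ : w.1.1 =ᵐ[volume.restrict Ω] φ) :
    grad w =ᵐ[volume.restrict Ω] gradient φ := by
  have hφ1 : ContDiff ℝ 1 φ := hφ.1.of_le (by simp)
  exact IsWeakGrad.ae_eq (p := p) hΩo hwφ w.2 (isWeakGrad_gradient hφ1) (memLp_grad w)
    (memLp_of_continuous_bounded hΩb (continuous_gradient hφ1) _)

theorem exists_poincare (hn : 0 < n) (hΩo : IsOpen Ω) (hΩb : Bornology.IsBounded Ω) :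
    ∃ C : ℝ, 0 ≤ C ∧ ∀ w ∈ W1p0 p Ω, ‖w.1.1‖ ≤ C * ‖w.1.2‖ := by
  have hp1 : 1 < p := hp.out
  have hp0 : 0 < p := by linarith
  obtain ⟨R, hR0, hR⟩ := hΩb.exists_pos_norm_le
  set K : ℝ := 2 * ((2 * (p - 1)) ^ (p - 1) * R ^ p) with hK
  have hp2 : 0 < p - 1 := by linarith
  have hK0 : 0 ≤ K := by positivity
  refine ⟨K ^ p⁻¹, by positivity, fun w hw => ?_⟩
  have hcl : IsClosed {w : W1p p Ω | ‖w.1.1‖ ≤ K ^ p⁻¹ * ‖w.1.2‖} :=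
    isClosed_le (continuous_fst.comp continuous_subtype_val).norm
      (continuous_const.mul (continuous_snd.comp continuous_subtype_val).norm)
  have hsub : closure (testSubspace p Ω : Set (W1p p Ω)) ⊆
      {w : W1p p Ω | ‖w.1.1‖ ≤ K ^ p⁻¹ * ‖w.1.2‖} := by
    refine closure_minimal ?_ hcl
    rintro w ⟨φ, hφ, hwφ⟩
    have hφ1 : ContDiff ℝ 1 φ := hφ.1.of_le (by simp)
    have hgr := grad_eq_gradient_of_isTest hΩo hΩb hφ hwφ
    have hmain := integral_norm_rpow_le hp1 (e := EuclideanSpace.single (⟨0, hn⟩ : Fin n) (1 : ℝ))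
      (by simp) hφ1 hφ.2.1 (R := R) (fun x hx => hR x (hφ.2.2 (subset_tsupport φ hx)))
    have e1 : ‖w.1.1‖ ^ p = ∫ x, ‖φ x‖ ^ p := by
      rw [Lp_norm_rpow,
        ← setIntegral_eq_integral_of_forall_compl_eq_zero (s := Ω) (f := fun x => ‖φ x‖ ^ p)]
      · refine integral_congr_ae ?_
        filter_upwards [hwφ] with x hx
        rw [hx]
      · intro x hx
        rw [image_eq_zero_of_notMem_tsupport fun h => hx (hφ.2.2 h)]
        simp [hp0.ne']
    have e2 : ‖w.1.2‖ ^ p = ∫ x, ‖gradient φ x‖ ^ p := by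
      rw [Lp_norm_rpow, ← setIntegral_eq_integral_of_forall_compl_eq_zero (s := Ω)
        (f := fun x => ‖gradient φ x‖ ^ p)]
      · refine integral_congr_ae ?_
        filter_upwards [hgr] with x hx
        rw [← hx]; rfl
      · intro x hx
        have : fderiv ℝ φ x = 0 :=
          image_eq_zero_of_notMem_tsupport fun h => hx (hφ.2.2 (tsupport_fderiv_subset ℝ h))
        rw [gradient, this, map_zero]
        simp [hp0.ne']
    rw [← e1, ← e2, ← hK] at hmain
    rw [mem_ofPred_eq, ← Real.rpow_le_rpow_iff (norm_nonneg _) (by positivity) hp0,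
      Real.mul_rpow (by positivity) (norm_nonneg _), Real.rpow_inv_rpow hK0 hp0.ne']
    exact hmain
  exact hsub hw

theorem isClosed_W1p0 : IsClosed (W1p0 p Ω : Set (W1p p Ω)) :=
  (testSubspace p Ω).isClosed_topologicalClosure

theorem cauchySeq_iff_norm_sub {X : Type*} [SeminormedAddCommGroup X] {v : ℕ → X} :
    CauchySeq v ↔ ∀ δ > 0, ∃ N, ∀ k ≥ N, ‖v k - v N‖ < δ := by
  simp only [Metric.cauchySeq_iff', dist_eq_norm]

theorem W1p.norm_lt {w : W1p p Ω} {δ : ℝ} (h1 : ‖w.1.1‖ < δ) (h2 : ‖w.1.2‖ < δ) : ‖w‖ < δ :=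
  max_lt h1 h2

theorem W1p.sub_snd (u v : W1p p Ω) : (u - v).1.2 = u.1.2 - v.1.2 := rfl

/-- The arithmetic of the Cauchy argument: a and b stand for almost minimal energies and M for the
energy of the midpoint. The first term on the right of the last hypothesis is at most cD/2 and the
second at most cD/4. -/
theorem lt_of_almost_minimal {c D m C a b M X : ℝ} (hc : 0 < c) (hD : 0 < D) (hm : 0 ≤ m)
    (hC : 0 ≤ C) (ha : a < m + min 1 (c * D / (4 * (C + 1))))
    (hb : b < m + min 1 (c * D / (4 * (C + 1)))) (hM : m ≤ M)
    (h : c * X ≤ c * D / (4 * (m + 1)) * (a + b) + C * ((a + b) / 2 - M)) : X < D := by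
  set η : ℝ := min 1 (c * D / (4 * (C + 1))) with hη
  have hη1 : η ≤ 1 := min_le_left _ _
  have h2 : c * D / (4 * (m + 1)) * (a + b) ≤ c * D / 2 := by
    calc c * D / (4 * (m + 1)) * (a + b)
        ≤ c * D / (4 * (m + 1)) * (2 * (m + 1)) := by gcongr; linarith
      _ = c * D / 2 := by field_simp; norm_num
  have h3 : C * ((a + b) / 2 - M) ≤ c * D / 4 := by
    have hη0 : 0 < η := by positivity
    calc C * ((a + b) / 2 - M) ≤ C * η := by gcongr; linarith
      _ ≤ (C + 1) * (c * D / (4 * (C + 1))) := by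
          gcongr
          · linarith
          · exact min_le_right _ _
      _ = c * D / 4 := by field_simp
  have h5 : 0 < c * D := by positivity
  refine lt_of_mul_lt_mul_left ?_ hc.le
  linarith

theorem cauchySeq_grad_of_tendsto_energy {σ : E n → ℝ} (hσ : IsConductivity Ω σ)
    {v : ℕ → W1p p Ω} {m : ℝ} (hm0 : 0 ≤ m) (he : Tendsto (fun k => energy σ (v k)) atTop (𝓝 m))
    (hml : ∀ j k, m ≤ energy σ ((1 / 2 : ℝ) • (v j + v k))) :
    CauchySeq fun k => (v k).1.2 := by
  have hp1 : 1 < p := hp.out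
  have hp0 : 0 < p := by linarith
  obtain ⟨c, hc, hcσ⟩ := hσ.2
  refine cauchySeq_iff_norm_sub.2 fun δ hδ => ?_
  have hD : 0 < δ ^ p := by positivity
  obtain ⟨C, hC0, hC⟩ := energy_sub_le (n := n) (p := p) (Ω := Ω)
    (ε := c * δ ^ p / (4 * (m + 1))) (by positivity)
  have hη0 : 0 < min 1 (c * δ ^ p / (4 * (C + 1))) := by positivity
  obtain ⟨N, hN⟩ := ((tendsto_order.1 he).2 _ (lt_add_of_pos_right m hη0)).exists_forall_of_atTop
  refine ⟨N, fun k hk => ?_⟩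
  have h6 : ‖(v k - v N).1.2‖ ^ p < δ ^ p :=
    lt_of_almost_minimal hc hD hm0 hC0 (hN k hk) (hN N le_rfl) (hml k N)
      ((le_energy hσ.1 hcσ (v k - v N)).trans (hC σ hσ.1 hσ.nonneg (v k) (v N)))
  exact (Real.rpow_lt_rpow_iff (norm_nonneg (v k - v N).1.2) hδ.le hp0).1 h6

/-- Differences lie in the closure of the test functions, where the Poincaré inequality controls the
function by its gradient. -/
theorem cauchySeq_of_cauchySeq_grad {K : ℝ} (hK0 : 0 ≤ K)
    (hK : ∀ w ∈ W1p0 p Ω, ‖w.1.1‖ ≤ K * ‖w.1.2‖) {v : ℕ → W1p p Ω}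
    (hv : ∀ j k, v j - v k ∈ W1p0 p Ω) (hcauchy : CauchySeq fun k => (v k).1.2) :
    CauchySeq v := by
  refine cauchySeq_iff_norm_sub.2 fun δ hδ => ?_
  obtain ⟨N, hN⟩ := cauchySeq_iff_norm_sub.1 hcauchy (δ / (K + 1)) (by positivity)
  refine ⟨N, fun k hk => ?_⟩
  have h1 := hN k hk
  have h2 := hK (v k - v N) (hv k N)
  rw [← W1p.sub_snd, lt_div_iff₀ (by positivity)] at h1
  have h3 := norm_nonneg (v k - v N).1.2
  exact W1p.norm_lt (by nlinarith) (by nlinarith)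

/-- Lower semicontinuity from the tangent inequality at the limit, whose linear term tends to 0. -/
theorem energy_le_of_tendsto {σ : E n → ℝ} (hσ : IsConductivity Ω σ) {v : ℕ → W1p p Ω}
    {u : W1p p Ω} (hu : Tendsto v atTop (𝓝 u)) {m : ℝ}
    (he : Tendsto (fun k => energy σ (v k)) atTop (𝓝 m)) : energy σ u ≤ m := by
  obtain ⟨L, hL⟩ := exists_clm_weakForm hσ.1 u
  have h0 : Tendsto (fun k => L (v k)) atTop (𝓝 (L u)) := (L.continuous.tendsto u).comp hu
  have h1 : Tendsto (fun k => energy σ u + p * (L (v k) - L u)) atTop (𝓝 (energy σ u)) := by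
    simpa using ((h0.sub_const (L u)).const_mul p).const_add (energy σ u)
  refine le_of_tendsto_of_tendsto' h1 he fun k => ?_
  have ht := energy_tangent hσ.1 hσ.nonneg u (v k)
  rwa [weakForm_sub hσ.1, ← hL, ← hL] at ht

theorem exists_isMinimizer (hn : 0 < n) (hΩo : IsOpen Ω) (hΩb : Bornology.IsBounded Ω)
    {σ : E n → ℝ} (hσ : IsConductivity Ω σ) (f : BdryVal p Ω) : ∃ u, IsMinimizer σ f u := by
  obtain ⟨K, hK0, hK⟩ := exists_poincare (p := p) hn hΩo hΩb
  set S : Set ℝ := {e | ∃ v : W1p p Ω, (W1p0 p Ω).mkQ v = f ∧ energy σ v = e} with hS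
  have hSne : S.Nonempty := ⟨_, rep f, mkQ_rep f, rfl⟩
  have hSb : BddBelow S := ⟨0, by rintro _ ⟨v, _, rfl⟩; exact energy_nonneg hσ.nonneg v⟩
  set m := sInf S with hm
  have hml : ∀ v : W1p p Ω, (W1p0 p Ω).mkQ v = f → m ≤ energy σ v := fun v hv =>
    csInf_le hSb ⟨v, hv, rfl⟩
  obtain ⟨e, -, he, heS⟩ := exists_seq_tendsto_sInf hSne hSb
  choose v hvf hve using heS
  have hcauchy : CauchySeq v := by
    refine cauchySeq_of_cauchySeq_grad hK0 hK (fun j k => mkQ_eq_iff.1 ((hvf j).trans (hvf k).symm))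
      (cauchySeq_grad_of_tendsto_energy hσ (m := m) ?_ ?_
        fun j k => hml _ (mkQ_midpoint (hvf j) (hvf k)))
    · exact le_csInf hSne (by rintro _ ⟨v, _, rfl⟩; exact energy_nonneg hσ.nonneg v)
    · simp only [hve]; exact he
  obtain ⟨u, hu⟩ := cauchySeq_tendsto_of_complete hcauchy
  have huf : (W1p0 p Ω).mkQ u = f := by
    rw [← hvf 0, mkQ_eq_iff]
    refine isClosed_W1p0.mem_of_tendsto (hu.sub_const (v 0)) (Eventually.of_forall fun k => ?_)
    exact mkQ_eq_iff.1 ((hvf k).trans (hvf 0).symm)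
  have hum : energy σ u ≤ m := energy_le_of_tendsto hσ hu (by simpa only [hve] using he)
  exact ⟨u, huf, fun v hv => hum.trans (hml v hv)⟩

theorem isMinimizer_sol (hn : 0 < n) (hΩo : IsOpen Ω) (hΩb : Bornology.IsBounded Ω)
    {σ : E n → ℝ} (hσ : IsConductivity Ω σ) (f : BdryVal p Ω) : IsMinimizer σ f (sol σ f) :=
  Classical.epsilon_spec (exists_isMinimizer hn hΩo hΩb hσ f)

end Existence

/-! ### Monotonicity estimates and marked sets -/

section Monotonicity

variable {n : ℕ} {p : ℝ} [hp : Fact (1 < p)] {Ω : Set (E n)}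

theorem isConductivity_one : IsConductivity Ω (fun _ => (1 : ℝ)) :=
  ⟨memLp_top_const 1, 1, one_pos, Eventually.of_forall fun _ => le_rfl⟩

theorem energy_one (u : W1p p Ω) : energy (fun _ => 1) u = ∫ x in Ω, ‖grad u x‖ ^ p := by
  simp only [energy, one_mul]

theorem integrable_grad (u : W1p p Ω) : IntegrableOn (fun x => ‖grad u x‖ ^ p) Ω :=
  integrable_norm_rpow_of_memLp hp.out (memLp_grad u)

theorem dnMap_eq_weakForm (σ : E n → ℝ) (f g : BdryVal p Ω) :
    dnMap σ f g = weakForm σ (sol σ f) (rep g) := by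
  simp only [dnMap, weakForm, pflux, real_inner_smul_left, mul_assoc]

theorem testOp_diag (B : Set (E n)) (f : BdryVal p Ω) :
    testOp B f f = ∫ x in B, ‖grad (sol (fun _ => 1) f) x‖ ^ p := by
  simp only [testOp, ← real_inner_smul_left]
  exact integral_congr_ae (Eventually.of_forall fun x => inner_pflux_self hp.out _)

/-- Representatives of one boundary value differ by an element on which the weak form of the
minimizer vanishes, so the choice of representative is immaterial. -/
theorem IsMinimizer.weakForm_eq {σ : E n → ℝ} (hσ : IsConductivity Ω σ) {f : BdryVal p Ω}
    {u v : W1p p Ω} (hu : IsMinimizer σ f u) (hv : (W1p0 p Ω).mkQ v = f) :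
    weakForm σ u v = energy σ u := by
  have h := weak_eq_zero_of_isMinimizer hσ.1 hσ.nonneg hu (mkQ_eq_iff.1 (hv.trans hu.1.symm))
  rw [weakForm_sub hσ.1, weakForm_self] at h
  linarith

theorem dnMap_diag (hn : 0 < n) (hΩo : IsOpen Ω) (hΩb : Bornology.IsBounded Ω)
    {σ : E n → ℝ} (hσ : IsConductivity Ω σ) (f : BdryVal p Ω) :
    dnMap σ f f = energy σ (sol σ f) := by
  rw [dnMap_eq_weakForm]
  exact (isMinimizer_sol hn hΩo hΩb hσ f).weakForm_eq hσ (mkQ_rep f)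

theorem integrable_mul_grad {τ : E n → ℝ} (hτ : MemLp τ ∞ (volume.restrict Ω)) (u : W1p p Ω) :
    IntegrableOn (fun x => τ x * ‖grad u x‖ ^ p) Ω :=
  integrable_mul_of_memLp_top hτ (integrable_grad u)

theorem dnMap_sub_le (hn : 0 < n) (hΩo : IsOpen Ω) (hΩb : Bornology.IsBounded Ω)
    {σ : E n → ℝ} (hσ : IsConductivity Ω σ) (f : BdryVal p Ω) :
    dnMap σ f f - dnMap (fun _ => 1) f f ≤
      ∫ x in Ω, (σ x - 1) * ‖grad (sol (fun _ => 1) f) x‖ ^ p := by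
  have h1 := isMinimizer_sol hn hΩo hΩb hσ f
  have h0 := isMinimizer_sol hn hΩo hΩb isConductivity_one f
  rw [dnMap_diag hn hΩo hΩb hσ, dnMap_diag hn hΩo hΩb isConductivity_one, energy_one]
  have hle := h1.2 _ h0.1
  have hi := integral_sub (integrable_energy hσ.1 (sol (fun _ => 1) f))
    (integrable_grad (sol (fun _ => (1 : ℝ)) f))
  simp only [sub_mul, one_mul]
  rw [hi]
  exact sub_le_sub_right hle _

theorem memLp_rpow_neg {σ : E n → ℝ} (hσ : IsConductivity Ω σ) :
    MemLp (fun x => σ x ^ (-1 / (p - 1))) ∞ (volume.restrict Ω) := by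
  obtain ⟨c, hc, hcσ⟩ := hσ.2
  have hp1 : 0 < p - 1 := by linarith [hp.out]
  refine memLp_top_of_bound (hσ.1.1.aemeasurable.pow_const _).aestronglyMeasurable
    (c ^ (-1 / (p - 1))) ?_
  filter_upwards [hcσ] with x hx
  rw [Real.norm_of_nonneg (Real.rpow_nonneg (hc.le.trans hx) _)]
  exact Real.rpow_le_rpow_of_nonpos hc hx (by rw [neg_div]; simpa using hp1.le)

/-- The energy of u₀ equals its weak form against u_σ. Young's inequality with the pointwise weight
s = σ(x) makes the |∇u_σ|^p term exactly the energy of u_σ. -/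
theorem le_dnMap_sub (hn : 0 < n) (hΩo : IsOpen Ω) (hΩb : Bornology.IsBounded Ω)
    {σ : E n → ℝ} (hσ : IsConductivity Ω σ) (f : BdryVal p Ω) :
    ∫ x in Ω, (p - 1) * (1 - σ x ^ (-1 / (p - 1))) * ‖grad (sol (fun _ => 1) f) x‖ ^ p ≤
      dnMap σ f f - dnMap (fun _ => 1) f f := by
  have h1 := isMinimizer_sol hn hΩo hΩb hσ f
  have h0 := isMinimizer_sol hn hΩo hΩb isConductivity_one f
  have hw := h0.weakForm_eq isConductivity_one h1.1
  rw [dnMap_diag hn hΩo hΩb hσ, dnMap_diag hn hΩo hΩb isConductivity_one]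
  set u0 := sol (fun _ => (1 : ℝ)) f
  set u1 := sol σ f
  obtain ⟨c, hc, hcσ⟩ := hσ.2
  have i0 := (integrable_weakForm (isConductivity_one (Ω := Ω)).1 u0 u1).const_mul p
  have i1 := integrable_energy hσ.1 u1
  have i2 := (integrable_mul_grad (memLp_rpow_neg (p := p) hσ) u0).const_mul (p - 1)
  have i3 := (integrable_grad u0).const_mul (p - 1)
  have hle : p * weakForm (fun _ => 1) u0 u1 ≤ energy σ u1 +
      (p - 1) * ∫ x in Ω, σ x ^ (-1 / (p - 1)) * ‖grad u0 x‖ ^ p := by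
    rw [weakForm, energy, ← integral_const_mul, ← integral_const_mul, ← integral_add i1 i2]
    refine integral_mono_ae i0 (i1.add i2) ?_
    filter_upwards [hcσ] with x hx
    have := inner_pflux_le hp.out (hc.trans_le hx) (grad u1 x) (grad u0 x)
    rw [one_mul]
    linarith
  have e : ∫ x in Ω, (p - 1) * (1 - σ x ^ (-1 / (p - 1))) * ‖grad u0 x‖ ^ p =
      (p - 1) * energy (fun _ => 1) u0 -
        (p - 1) * ∫ x in Ω, σ x ^ (-1 / (p - 1)) * ‖grad u0 x‖ ^ p := by
    rw [energy_one, ← integral_const_mul, ← integral_const_mul, ← integral_sub i3 i2]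
    refine integral_congr_ae (Eventually.of_forall fun x => ?_)
    simp only
    ring
  rw [hw] at hle
  rw [e]
  linarith

theorem integral_mul_grad_abs_le {τ : E n → ℝ} (hτ : MemLp τ ∞ (volume.restrict Ω)) {H : Set (E n)}
    (hH : MeasurableSet H) (hz : ∀ᵐ x ∂(volume.restrict Ω), x ∉ H → τ x = 0) :
    ∃ C : ℝ, 0 ≤ C ∧ ∀ u : W1p p Ω, |∫ x in Ω, τ x * ‖grad u x‖ ^ p| ≤
      C * ∫ x in Ω ∩ H, ‖grad u x‖ ^ p := by
  obtain ⟨C, hC⟩ : ∃ C, ∀ᵐ x ∂(volume.restrict Ω), ‖τ x‖ ≤ C := by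
    refine ⟨(eLpNormEssSup τ (volume.restrict Ω)).toReal, ?_⟩
    filter_upwards [enorm_ae_le_eLpNormEssSup τ (volume.restrict Ω)] with x hx
    have := ENNReal.toReal_mono (by simpa using hτ.2.ne) hx
    simpa using this
  refine ⟨max C 0, le_max_right _ _, fun u => ?_⟩
  rw [inter_comm, ← Measure.restrict_restrict hH, ← integral_indicator hH, ← integral_const_mul,
    ← Real.norm_eq_abs]
  refine norm_integral_le_of_norm_le (((integrable_grad u).indicator hH).const_mul _) ?_
  filter_upwards [hC, hz] with x hx hxz
  by_cases hxH : x ∈ H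
  · rw [indicator_of_mem hxH, norm_mul, Real.norm_of_nonneg (Real.rpow_nonneg (norm_nonneg _) p)]
    gcongr
    exact hx.trans (le_max_left _ _)
  · rw [indicator_of_notMem hxH, hxz hxH]; simp

/-- On a marked set, the energy of every solution is controlled by its energy on the set where the
conductivity may differ from `1`. -/
theorem exists_bound_of_marked (hn : 0 < n) (hΩo : IsOpen Ω) (hΩb : Bornology.IsBounded Ω)
    {σ : E n → ℝ} (hσ : IsConductivity Ω σ) {H : Set (E n)}
    (hH : MeasurableSet H) (hz : ∀ᵐ x ∂(volume.restrict Ω), x ∉ H → σ x = 1) {B : Set (E n)}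
    (hB : B ∈ marked p Ω σ) : ∃ C : ℝ, 0 ≤ C ∧ ∀ f : BdryVal p Ω,
      ∫ x in B, ‖grad (sol (fun _ => 1) f) x‖ ^ p ≤
        C * ∫ x in Ω ∩ H, ‖grad (sol (fun _ => 1) f) x‖ ^ p := by
  obtain ⟨-, -, α, hα, hor⟩ := hB
  have key : ∀ {C : ℝ} {a b : ℝ}, α * a ≤ C * b → a ≤ C / α * b := by
    intro C a b h
    rw [div_mul_eq_mul_div, le_div_iff₀ hα]; linarith
  rcases hor with hor | hor
  -- A set marked from below uses the upper estimate; one marked from above uses the lower estimate.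
  -- Each density vanishes outside H.
  · obtain ⟨C, hC0, hC⟩ := integral_mul_grad_abs_le (p := p) (τ := fun x => σ x - 1)
      (hσ.1.sub (memLp_top_const 1)) hH (by filter_upwards [hz] with x hx h; rw [hx h, sub_self])
    refine ⟨C / α, by positivity, fun f => key ?_⟩
    have h1 := hor f
    simp only [Pi.sub_apply, Pi.add_apply, Pi.smul_apply, smul_eq_mul, testOp_diag] at h1
    have h2 := dnMap_sub_le hn hΩo hΩb hσ f
    have h3 := hC (sol (fun _ => 1) f)
    have h4 := le_abs_self (∫ x in Ω, (σ x - 1) * ‖grad (sol (fun _ => 1) f) x‖ ^ p)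
    linarith
  · obtain ⟨C, hC0, hC⟩ := integral_mul_grad_abs_le (p := p)
      (τ := fun x => (p - 1) * (1 - σ x ^ (-1 / (p - 1))))
      (((memLp_top_const 1).sub (memLp_rpow_neg (p := p) hσ)).const_mul (p - 1)) hH
      (by filter_upwards [hz] with x hx h; rw [hx h, Real.one_rpow, sub_self, mul_zero])
    refine ⟨C / α, by positivity, fun f => key ?_⟩
    have h1 := hor f
    simp only [Pi.sub_apply, Pi.smul_apply, smul_eq_mul, testOp_diag] at h1
    have h2 := le_dnMap_sub hn hΩo hΩb hσ f
    have h3 := hC (sol (fun _ => 1) f)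
    have h4 := neg_abs_le (∫ x in Ω, (p - 1) * (1 - σ x ^ (-1 / (p - 1))) *
      ‖grad (sol (fun _ => 1) f) x‖ ^ p)
    linarith

theorem mul_setIntegral_grad_le {τ : E n → ℝ} (hτ : MemLp τ ∞ (volume.restrict Ω)) {α : ℝ}
    (h0 : ∀ᵐ x ∂(volume.restrict Ω), 0 ≤ τ x) {B : Set (E n)} (hBΩ : B ⊆ Ω)
    (hB : NullMeasurableSet B volume) (hα : ∀ᵐ x ∂(volume.restrict Ω), x ∈ B → α ≤ τ x)
    (u : W1p p Ω) :
    α * ∫ x in B, ‖grad u x‖ ^ p ≤ ∫ x in Ω, τ x * ‖grad u x‖ ^ p := by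
  have hi := integrable_mul_grad hτ u
  calc α * ∫ x in B, ‖grad u x‖ ^ p = ∫ x in B, α * ‖grad u x‖ ^ p := by
        rw [integral_const_mul]
    _ ≤ ∫ x in B, τ x * ‖grad u x‖ ^ p := by
        refine integral_mono_ae (((integrable_grad u).mono_set hBΩ).const_mul α)
          (hi.mono_set hBΩ) ?_
        filter_upwards [ae_restrict_of_ae_restrict_of_subset hBΩ hα, ae_restrict_mem₀ hB]
          with x hx hxB
        exact mul_le_mul_of_nonneg_right (hx hxB) (by positivity)
    _ ≤ ∫ x in Ω, τ x * ‖grad u x‖ ^ p := by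
        refine setIntegral_mono_set hi ?_ hBΩ.eventuallyLE
        filter_upwards [h0] with x hx
        exact mul_nonneg hx (by positivity)

/-- The density of the lower estimate increases with σ, so its value at σ = 1 + δ serves as α. -/
theorem mem_marked_of_le (hn : 0 < n) (hΩo : IsOpen Ω) (hΩb : Bornology.IsBounded Ω)
    {σ : E n → ℝ} (hσ : IsConductivity Ω σ)
    (hmono : ∀ᵐ x ∂(volume.restrict Ω), 1 ≤ σ x) {B : Set (E n)} (hBΩ : B ⊆ Ω)
    (hB : NullMeasurableSet B volume) {δ : ℝ} (hδ : 0 < δ) (h : ∀ x ∈ B, 1 + δ ≤ σ x) :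
    B ∈ marked p Ω σ := by
  have hp1 : 0 < p - 1 := by linarith [hp.out]
  have hexp : -1 / (p - 1) < 0 := div_neg_of_neg_of_pos (by norm_num) hp1
  have hlt : (1 + δ) ^ (-1 / (p - 1)) < 1 := Real.rpow_lt_one_of_one_lt_of_neg (by linarith) hexp
  refine ⟨hBΩ, hB, (p - 1) * (1 - (1 + δ) ^ (-1 / (p - 1))), mul_pos hp1 (by linarith),
    Or.inl fun f => ?_⟩
  simp only [Pi.sub_apply, Pi.add_apply, Pi.smul_apply, smul_eq_mul, testOp_diag]
  have h1 := le_dnMap_sub hn hΩo hΩb hσ f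
  have h2 := mul_setIntegral_grad_le (p := p)
    (((memLp_top_const 1).sub (memLp_rpow_neg (p := p) hσ)).const_mul (p - 1))
    (α := (p - 1) * (1 - (1 + δ) ^ (-1 / (p - 1)))) ?_ hBΩ hB ?_ (sol (fun _ => 1) f)
  · simp only [Pi.sub_apply] at h2
    linarith
  · filter_upwards [hmono] with x hx
    exact mul_nonneg hp1.le (sub_nonneg.2 (Real.rpow_le_one_of_one_le_of_nonpos hx hexp.le))
  · refine Eventually.of_forall fun x hx => mul_le_mul_of_nonneg_left ?_ hp1.le
    exact sub_le_sub_left (Real.rpow_le_rpow_of_nonpos (by linarith) (h x hx) hexp.le) _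

/-- Here the upper estimate suffices, as 1 - σ ≥ δ on B; hence α = δ. -/
theorem mem_marked_of_ge (hn : 0 < n) (hΩo : IsOpen Ω) (hΩb : Bornology.IsBounded Ω)
    {σ : E n → ℝ} (hσ : IsConductivity Ω σ)
    (hmono : ∀ᵐ x ∂(volume.restrict Ω), σ x ≤ 1) {B : Set (E n)} (hBΩ : B ⊆ Ω)
    (hB : NullMeasurableSet B volume) {δ : ℝ} (hδ : 0 < δ) (h : ∀ x ∈ B, σ x ≤ 1 - δ) :
    B ∈ marked p Ω σ := by
  refine ⟨hBΩ, hB, δ, hδ, Or.inr fun f => ?_⟩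
  simp only [Pi.sub_apply, Pi.smul_apply, smul_eq_mul, testOp_diag]
  have h1 := dnMap_sub_le hn hΩo hΩb hσ f
  have h2 := mul_setIntegral_grad_le (p := p) (τ := fun x => 1 - σ x)
    ((memLp_top_const 1).sub hσ.1) (α := δ) ?_ hBΩ hB ?_ (sol (fun _ => 1) f)
  · have e : ∫ x in Ω, (σ x - 1) * ‖grad (sol (fun _ => 1) f) x‖ ^ p =
        - ∫ x in Ω, (1 - σ x) * ‖grad (sol (fun _ => 1) f) x‖ ^ p := by
      rw [← integral_neg]
      refine integral_congr_ae (Eventually.of_forall fun x => ?_)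
      simp only
      ring
    linarith
  · filter_upwards [hmono] with x hx using sub_nonneg.2 hx
  · exact Eventually.of_forall fun x hx => by linarith [h x hx]

end Monotonicity

/-! ### The ordinary differential equations of Wolff's profile -/

section WolffODE

/-- The autonomous equation for the phase of Wolff's periodic profile. -/
theorem exists_wolff_phase {c : ℝ} (hc : 0 < c) :
    ∃ φ : ℝ → ℝ, ∀ t, HasDerivAt φ (c * Real.cos (φ t) ^ 2 + Real.sin (φ t) ^ 2)⁻¹ t := by
  -- S is an antiderivative of c cos² + sin². Separating variables makes φ the inverse of S, which
  -- is a bijection because it is strictly increasing and a bounded perturbation of a linear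
  -- function.
  set S : ℝ → ℝ := fun s => (c + 1) / 2 * s + (c - 1) / 2 * (Real.sin s * Real.cos s) with hS
  have hk : ∀ s, 0 < c * Real.cos s ^ 2 + Real.sin s ^ 2 := by
    intro s
    have h := Real.sin_sq_add_cos_sq s
    rcases (sq_nonneg (Real.sin s)).lt_or_eq with h1 | h1
    · positivity
    · rw [← h1, zero_add] at h
      rw [← h1, h]; linarith
  have hSd : ∀ s, HasDerivAt S (c * Real.cos s ^ 2 + Real.sin s ^ 2) s := by
    intro s
    have h := ((hasDerivAt_id s).const_mul ((c + 1) / 2)).add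
      (((Real.hasDerivAt_sin s).mul (Real.hasDerivAt_cos s)).const_mul ((c - 1) / 2))
    refine h.congr_deriv ?_
    have h := Real.sin_sq_add_cos_sq s
    linear_combination (-(c + 1) / 2) * h
  have hSm : StrictMono S := strictMono_of_deriv_pos fun s => by rw [(hSd s).deriv]; exact hk s
  have hSc : Continuous S := continuous_iff_continuousAt.2 fun s => (hSd s).continuousAt
  have hb : ∀ s, |(c - 1) / 2 * (Real.sin s * Real.cos s)| ≤ |(c - 1) / 2| := by
    intro s
    rw [abs_mul, abs_mul]
    exact mul_le_of_le_one_right (abs_nonneg _)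
      (mul_le_one₀ (Real.abs_sin_le_one s) (abs_nonneg _) (Real.abs_cos_le_one s))
  have hSs : Function.Surjective S := by
    have hc2 : 0 < (c + 1) / 2 := by linarith
    refine hSc.surjective ?_ ?_
    · refine tendsto_atTop_mono (f := fun s => (c + 1) / 2 * s - |(c - 1) / 2|) (fun s => ?_)
        (tendsto_atTop_add_const_right _ _ (tendsto_id.const_mul_atTop hc2))
      have := (abs_le.1 (hb s)).1
      simp only [hS]; linarith
    · refine tendsto_atBot_mono (f := fun s => (c + 1) / 2 * s + |(c - 1) / 2|) (fun s => ?_)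
        (tendsto_atBot_add_const_right _ _ (tendsto_id.const_mul_atBot hc2))
      have := (abs_le.1 (hb s)).2
      simp only [hS]; linarith
  set e := hSm.orderIsoOfSurjective S hSs with he
  refine ⟨e.symm, fun t => ?_⟩
  refine HasDerivAt.of_local_left_inverse (f := S) e.symm.continuous.continuousAt
    (hSd _) (hk _).ne' (Eventually.of_forall fun y => ?_)
  exact e.apply_symm_apply y

/-- Wolff's periodic profile: `w = r cos φ` with `w' = -r sin φ`, and
`(-r^{p-1} sin φ)' = -(p-1) r^{p-1} cos φ`. -/
theorem exists_wolff_profile {p : ℝ} (hp : 1 < p) : ∃ φ r : ℝ → ℝ, ∃ m M : ℝ, 0 < m ∧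
    (∀ t, m ≤ r t ∧ r t ≤ M) ∧ Continuous φ ∧ Continuous r ∧
    (∀ t, HasDerivAt (fun t => r t * Real.cos (φ t)) (-(r t * Real.sin (φ t))) t) ∧
    (∀ t, DifferentiableAt ℝ (fun t => r t ^ (p - 1) * Real.cos (φ t)) t) ∧
    Continuous (deriv fun t => r t ^ (p - 1) * Real.cos (φ t)) ∧
    (∀ t, HasDerivAt (fun t => -(r t ^ (p - 1) * Real.sin (φ t)))
      (-((p - 1) * (r t ^ (p - 1) * Real.cos (φ t)))) t) := by
  have hp1 : 0 < p - 1 := by linarith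
  -- The two required equations are linear in φ' and (log r)'. Solving them gives φ' = 1/k and d(log
  -- r)/dφ = (p-2)/(p-1) sin φ cos φ, hence log r = κ sin² φ.
  obtain ⟨φ, hφ⟩ := exists_wolff_phase (c := 1 / (p - 1)) (by positivity)
  set κ : ℝ := (p - 2) / (2 * (p - 1)) with hκ
  set k : ℝ → ℝ := fun t => 1 / (p - 1) * Real.cos (φ t) ^ 2 + Real.sin (φ t) ^ 2 with hk
  have hk0 : ∀ t, k t ≠ 0 := by
    intro t
    have h := Real.sin_sq_add_cos_sq (φ t)
    have h2 : 0 < k t := by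
      rcases (sq_nonneg (Real.sin (φ t))).lt_or_eq with h1 | h1
      · positivity
      · rw [← h1, zero_add] at h
        simp only [hk]
        rw [← h1, h]; simpa using hp1
    exact h2.ne'
  have hφc : Continuous φ := continuous_iff_continuousAt.2 fun t => (hφ t).continuousAt
  have hkc : Continuous k := by fun_prop
  have hexp : ∀ c t : ℝ, HasDerivAt (fun t => Real.exp (c * Real.sin (φ t) ^ 2))
      (Real.exp (c * Real.sin (φ t) ^ 2) * (c * (2 * Real.sin (φ t) *
        (Real.cos (φ t) * (k t)⁻¹)))) t := by
    intro c t
    have h := ((((hφ t).sin).pow 2).const_mul c).exp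
    refine h.congr_deriv ?_
    simp only [Pi.pow_apply, hk]
    push_cast
    ring
  have hpow : ∀ t, Real.exp (κ * Real.sin (φ t) ^ 2) ^ (p - 1) =
      Real.exp ((p - 2) / 2 * Real.sin (φ t) ^ 2) := by
    intro t
    rw [← Real.exp_mul]
    congr 1
    rw [hκ]; field_simp
  have hcosd : ∀ t, HasDerivAt (fun t => Real.exp ((p - 2) / 2 * Real.sin (φ t) ^ 2) *
      Real.cos (φ t)) (Real.exp ((p - 2) / 2 * Real.sin (φ t) ^ 2) * ((p - 2) / 2 *
        (2 * Real.sin (φ t) * (Real.cos (φ t) * (k t)⁻¹))) * Real.cos (φ t) +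
        Real.exp ((p - 2) / 2 * Real.sin (φ t) ^ 2) * (-Real.sin (φ t) * (k t)⁻¹)) t :=
    fun t => (hexp _ t).mul (hφ t).cos
  refine ⟨φ, fun t => Real.exp (κ * Real.sin (φ t) ^ 2), Real.exp (-|κ|), Real.exp |κ|,
    Real.exp_pos _, ?_, hφc, by fun_prop, ?_, ?_, ?_, ?_⟩
  · intro t
    have h : |κ * Real.sin (φ t) ^ 2| ≤ |κ| := by
      rw [abs_mul]
      refine mul_le_of_le_one_right (abs_nonneg _) ?_
      rw [abs_of_nonneg (sq_nonneg _)]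
      exact Real.sin_sq_le_one _
    exact ⟨Real.exp_le_exp.2 (abs_le.1 h).1, Real.exp_le_exp.2 (abs_le.1 h).2⟩
  · intro t
    refine ((hexp κ t).mul (hφ t).cos).congr_deriv ?_
    have h := Real.sin_sq_add_cos_sq (φ t)
    have hkt : 2 * κ * Real.cos (φ t) ^ 2 - 1 = -k t := by
      have h2 : 2 * κ = 1 - 1 / (p - 1) := by rw [hκ]; field_simp; ring
      rw [h2]; simp only [hk]; linear_combination h
    have hkk := mul_inv_cancel₀ (hk0 t)
    change _ + Real.exp (κ * Real.sin (φ t) ^ 2) * (-Real.sin (φ t) * (k t)⁻¹) = _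
    linear_combination Real.exp (κ * Real.sin (φ t) ^ 2) * Real.sin (φ t) * (k t)⁻¹ * hkt -
      Real.exp (κ * Real.sin (φ t) ^ 2) * Real.sin (φ t) * hkk
  · intro t
    simp only [hpow]
    exact (hcosd t).differentiableAt
  · simp only [hpow]
    rw [funext fun t => (hcosd t).deriv]
    have : Continuous fun t => (k t)⁻¹ := hkc.inv₀ hk0
    fun_prop
  · intro t
    simp only [hpow]
    refine ((hexp ((p - 2) / 2) t).mul (hφ t).sin).neg.congr_deriv ?_
    have h := Real.sin_sq_add_cos_sq (φ t)
    have hkt : (p - 2) * Real.sin (φ t) ^ 2 + 1 = (p - 1) * k t := by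
      have h3 : (p - 1) * (1 / (p - 1)) = 1 := by field_simp
      simp only [hk]
      linear_combination -h - Real.cos (φ t) ^ 2 * h3
    have hkk := mul_inv_cancel₀ (hk0 t)
    change -(_ + Real.exp ((p - 2) / 2 * Real.sin (φ t) ^ 2) * (Real.cos (φ t) * (k t)⁻¹)) = _
    linear_combination -Real.exp ((p - 2) / 2 * Real.sin (φ t) ^ 2) * Real.cos (φ t) * (k t)⁻¹ * hkt
      - (p - 1) * Real.exp ((p - 2) / 2 * Real.sin (φ t) ^ 2) * Real.cos (φ t) * hkk

end WolffODE

/-! ### Wolff's exponentially growing solutions -/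

section Waves

variable {n : ℕ}

/-- The function `e^{a x·e₁} g(b x·e₂)`. -/
noncomputable def expWave (e₁ e₂ : E n) (a b : ℝ) (g : ℝ → ℝ) (x : E n) : ℝ :=
  Real.exp (a * inner ℝ e₁ x) * g (b * inner ℝ e₂ x)

theorem hasGradientAt_expWave (e₁ e₂ : E n) (a b : ℝ) {g : ℝ → ℝ} {x : E n} {g' : ℝ}
    (hg : HasDerivAt g g' (b * inner ℝ e₂ x)) :
    HasGradientAt (expWave e₁ e₂ a b g)
      (Real.exp (a * inner ℝ e₁ x) • ((a * g (b * inner ℝ e₂ x)) • e₁ + (b * g') • e₂)) x := by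
  rw [hasGradientAt_iff_hasFDerivAt]
  have h1 : HasFDerivAt (fun x : E n => a * inner ℝ e₁ x) (a • innerSL ℝ e₁) x :=
    (innerSL ℝ e₁).hasFDerivAt.const_mul a
  have h2 : HasFDerivAt (fun x : E n => b * inner ℝ e₂ x) (b • innerSL ℝ e₂) x :=
    (innerSL ℝ e₂).hasFDerivAt.const_mul b
  refine (h1.exp.mul (hg.comp_hasFDerivAt x h2)).congr_fderiv ?_
  ext y
  simp [InnerProductSpace.toDual_apply_apply]
  ring

theorem contDiff_expWave (e₁ e₂ : E n) (a b : ℝ) {g : ℝ → ℝ} (hg : ContDiff ℝ 1 g) :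
    ContDiff ℝ 1 (expWave e₁ e₂ a b g) :=
  (Real.contDiff_exp.comp (contDiff_const.mul (contDiff_const.inner ℝ contDiff_id))).mul
    (hg.comp (contDiff_const.mul (contDiff_const.inner ℝ contDiff_id)))

theorem fderiv_eq_inner_gradient (u : E n → ℝ) (x v : E n) :
    fderiv ℝ u x v = inner ℝ (gradient u x) v := by
  rw [gradient, InnerProductSpace.toDual_symm_apply]

theorem contDiff_one_of_hasDerivAt {g g' : ℝ → ℝ} (h : ∀ t, HasDerivAt g (g' t) t)
    (hg' : Continuous g') : ContDiff ℝ 1 g := by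
  rw [contDiff_one_iff_deriv]
  refine ⟨fun t => (h t).differentiableAt, ?_⟩
  rwa [funext fun t => (h t).deriv]

/-- Wolff's solutions `e^{τ x·e₁} w(τ x·e₂)` of the `p`-Laplace equation. -/
theorem exists_wolff_solution {p : ℝ} (hp : 1 < p) {e₁ e₂ : E n} (h₁ : ‖e₁‖ = 1) (h₂ : ‖e₂‖ = 1)
    (h₁₂ : inner ℝ e₁ e₂ = 0) : ∃ m M : ℝ, 0 < m ∧ ∀ τ : ℝ, 0 < τ → ∃ u : E n → ℝ,
      ContDiff ℝ 1 u ∧ (∀ x, m * (τ * Real.exp (τ * inner ℝ e₁ x)) ≤ ‖gradient u x‖ ∧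
        ‖gradient u x‖ ≤ M * (τ * Real.exp (τ * inner ℝ e₁ x))) ∧
      ∀ (Ω : Set (E n)) (ψ : E n → ℝ), IsTest Ω ψ →
        ∫ x in Ω, inner ℝ (pflux p (gradient u x)) (gradient ψ x) = 0 := by
  obtain ⟨φ, r, m, M, hm, hmM, hφc, hrc, hw, hq, hq', hy⟩ := exists_wolff_profile hp
  have hr0 : ∀ t, 0 < r t := fun t => hm.trans_le (hmM t).1
  have hrpc : Continuous fun t => r t ^ (p - 1) := hrc.rpow_const fun t => Or.inl (hr0 t).ne'
  have hwc : ContDiff ℝ 1 fun t => r t * Real.cos (φ t) :=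
    contDiff_one_of_hasDerivAt hw (by fun_prop)
  have hqc : ContDiff ℝ 1 fun t => r t ^ (p - 1) * Real.cos (φ t) :=
    contDiff_one_iff_deriv.2 ⟨hq, hq'⟩
  have hyc : ContDiff ℝ 1 fun t => -(r t ^ (p - 1) * Real.sin (φ t)) :=
    contDiff_one_of_hasDerivAt hy (by fun_prop)
  refine ⟨m, M, hm, fun τ hτ => ⟨expWave e₁ e₂ τ τ fun t => r t * Real.cos (φ t),
    contDiff_expWave _ _ _ _ hwc, ?_⟩⟩
  have hgrad : ∀ x, gradient (expWave e₁ e₂ τ τ fun t => r t * Real.cos (φ t)) x =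
      (τ * Real.exp (τ * inner ℝ e₁ x) * r (τ * inner ℝ e₂ x)) •
        (Real.cos (φ (τ * inner ℝ e₂ x)) • e₁ - Real.sin (φ (τ * inner ℝ e₂ x)) • e₂) := by
    intro x
    rw [(hasGradientAt_expWave e₁ e₂ τ τ (hw _)).gradient]
    module
  have hunit : ∀ s : ℝ, ‖Real.cos s • e₁ - Real.sin s • e₂‖ = 1 := by
    intro s
    have h : ‖Real.cos s • e₁ - Real.sin s • e₂‖ ^ 2 = 1 := by
      rw [norm_sub_sq_real, norm_smul, norm_smul, h₁, h₂, real_inner_smul_left,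
        real_inner_smul_right, h₁₂]
      simp
    exact (pow_eq_one_iff_of_nonneg (norm_nonneg _) two_ne_zero).1 h
  have hnorm : ∀ x, ‖gradient (expWave e₁ e₂ τ τ fun t => r t * Real.cos (φ t)) x‖ =
      τ * Real.exp (τ * inner ℝ e₁ x) * r (τ * inner ℝ e₂ x) := by
    intro x
    have := hr0 (τ * inner ℝ e₂ x)
    rw [hgrad, norm_smul, hunit, mul_one, Real.norm_of_nonneg (by positivity)]
  refine ⟨fun x => ?_, fun Ω ψ hψ => ?_⟩
  · rw [hnorm, mul_comm m, mul_comm M]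
    have h := hmM (τ * inner ℝ e₂ x)
    constructor
    · gcongr; exact h.1
    · gcongr; exact h.2
  -- V₁ and V₂ are the components of the flux along e₁ and e₂ without the factor τ^{p-1}. They are
  -- C¹ even where the flux map is not smooth, and the last profile equation makes the field
  -- divergence free.
  · set V₁ := expWave e₁ e₂ ((p - 1) * τ) τ fun t => r t ^ (p - 1) * Real.cos (φ t) with hV₁
    set V₂ := expWave e₁ e₂ ((p - 1) * τ) τ fun t => -(r t ^ (p - 1) * Real.sin (φ t)) with hV₂
    have hc₁ : ContDiff ℝ 1 V₁ := contDiff_expWave _ _ _ _ hqc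
    have hc₂ : ContDiff ℝ 1 V₂ := contDiff_expWave _ _ _ _ hyc
    have hflux : ∀ x, inner ℝ (pflux p (gradient (expWave e₁ e₂ τ τ
        fun t => r t * Real.cos (φ t)) x)) (gradient ψ x) =
        τ ^ (p - 1) * (V₁ x * fderiv ℝ ψ x e₁ + V₂ x * fderiv ℝ ψ x e₂) := by
      intro x
      have hr := hr0 (τ * inner ℝ e₂ x)
      have hpos : 0 < τ * Real.exp (τ * inner ℝ e₁ x) * r (τ * inner ℝ e₂ x) := by positivity
      have hpw : (τ * Real.exp (τ * inner ℝ e₁ x) * r (τ * inner ℝ e₂ x)) ^ (p - 2) *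
          (τ * Real.exp (τ * inner ℝ e₁ x) * r (τ * inner ℝ e₂ x)) =
          τ ^ (p - 1) * Real.exp ((p - 1) * τ * inner ℝ e₁ x) * r (τ * inner ℝ e₂ x) ^ (p - 1) := by
        rw [← Real.rpow_add_one hpos.ne', show p - 2 + 1 = p - 1 by ring,
          Real.mul_rpow (by positivity) hr.le, Real.mul_rpow hτ.le (Real.exp_pos _).le,
          ← Real.exp_mul, show τ * inner ℝ e₁ x * (p - 1) = (p - 1) * τ * inner ℝ e₁ x by ring]
      rw [pflux, hnorm, hgrad, smul_smul, hpw, real_inner_smul_left, inner_sub_left,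
        real_inner_smul_left, real_inner_smul_left, real_inner_comm (gradient ψ x) e₁,
        real_inner_comm (gradient ψ x) e₂,
        fderiv_eq_inner_gradient, fderiv_eq_inner_gradient]
      simp only [hV₁, hV₂, expWave]
      ring
    have i₁ : Integrable (fun x => V₁ x * fderiv ℝ ψ x e₁) (volume.restrict Ω) :=
      ((hc₁.continuous.mul ((hψ.1.continuous_fderiv (by simp)).clm_apply
        continuous_const)).integrable_of_hasCompactSupport
          (hψ.2.1.fderiv_apply (𝕜 := ℝ) e₁).mul_left).restrict
    have i₂ : Integrable (fun x => V₂ x * fderiv ℝ ψ x e₂) (volume.restrict Ω) :=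
      ((hc₂.continuous.mul ((hψ.1.continuous_fderiv (by simp)).clm_apply
        continuous_const)).integrable_of_hasCompactSupport
          (hψ.2.1.fderiv_apply (𝕜 := ℝ) e₂).mul_left).restrict
    have hdiv : ∀ x, fderiv ℝ V₁ x e₁ = - fderiv ℝ V₂ x e₂ := by
      intro x
      have e11 : inner ℝ e₁ e₁ = (1 : ℝ) := by rw [real_inner_self_eq_norm_sq, h₁, one_pow]
      have e22 : inner ℝ e₂ e₂ = (1 : ℝ) := by rw [real_inner_self_eq_norm_sq, h₂, one_pow]
      have e21 : inner ℝ e₂ e₁ = (0 : ℝ) := by rw [real_inner_comm, h₁₂]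
      rw [fderiv_eq_inner_gradient, fderiv_eq_inner_gradient, hV₁, hV₂,
        (hasGradientAt_expWave e₁ e₂ _ τ (hq _).hasDerivAt).gradient,
        (hasGradientAt_expWave e₁ e₂ _ τ (hy _)).gradient]
      simp only [real_inner_smul_left, inner_add_left, e11, e22, e21, h₁₂]
      ring
    simp only [hflux]
    rw [integral_const_mul, integral_add i₁ i₂, hψ.setIntegral_mul_fderiv hc₁,
      hψ.setIntegral_mul_fderiv hc₂]
    simp only [hdiv, neg_mul, integral_neg, neg_neg, add_neg_cancel, mul_zero]

end Waves

/-! ### Smooth solutions as solutions of the Dirichlet problem -/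

section WolffBoundary

variable {n : ℕ} {p : ℝ} [hp : Fact (1 < p)] {Ω : Set (E n)}

theorem exists_W1p_of_contDiff (hΩb : Bornology.IsBounded Ω) {u : E n → ℝ} (hu : ContDiff ℝ 1 u) :
    ∃ w : W1p p Ω, grad w =ᵐ[volume.restrict Ω] gradient u := by
  have m1 : MemLp u (ENNReal.ofReal p) (volume.restrict Ω) :=
    memLp_of_continuous_bounded hΩb hu.continuous _
  have m2 : MemLp (gradient u) (ENNReal.ofReal p) (volume.restrict Ω) :=
    memLp_of_continuous_bounded hΩb (continuous_gradient hu) _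
  refine ⟨⟨(m1.toLp u, m2.toLp (gradient u)), ?_⟩, m2.coeFn_toLp⟩
  intro φ hφ v
  have h := isWeakGrad_gradient (Ω := Ω) hu φ hφ v
  have e1 : ∫ x in Ω, m1.toLp u x * fderiv ℝ φ x v = ∫ x in Ω, u x * fderiv ℝ φ x v := by
    refine integral_congr_ae ?_
    filter_upwards [m1.coeFn_toLp] with x hx
    rw [hx]
  have e2 : ∫ x in Ω, φ x * inner ℝ (m2.toLp (gradient u) x) v =
      ∫ x in Ω, φ x * inner ℝ (gradient u x) v := by
    refine integral_congr_ae ?_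
    filter_upwards [m2.coeFn_toLp] with x hx
    rw [hx]
  exact e1.trans (h.trans (by rw [e2]))

/-- No boundary regularity enters: a C¹ function on the whole space is Sobolev on bounded Ω, its
class is the boundary value, and density of test functions makes it a minimizer. Uniqueness of
gradients identifies it with the chosen solution. -/
theorem exists_grad_sol_eq (hn : 0 < n) (hΩo : IsOpen Ω) (hΩb : Bornology.IsBounded Ω)
    {u : E n → ℝ} (hu : ContDiff ℝ 1 u) (hweak : ∀ ψ : E n → ℝ, IsTest Ω ψ →
      ∫ x in Ω, inner ℝ (pflux p (gradient u x)) (gradient ψ x) = 0) :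
    ∃ f : BdryVal p Ω, grad (sol (fun _ => 1) f) =ᵐ[volume.restrict Ω] gradient u := by
  obtain ⟨w, hw⟩ := exists_W1p_of_contDiff (p := p) hΩb hu
  have hmin : IsMinimizer (fun _ => 1) ((W1p0 p Ω).mkQ w) w := by
    refine isMinimizer_of_weak isConductivity_one.1 isConductivity_one.nonneg fun z hz => ?_
    obtain ⟨L, hL⟩ := exists_clm_weakForm (isConductivity_one (Ω := Ω)).1 w
    rw [← hL]
    have hsub : closure (testSubspace p Ω : Set (W1p p Ω)) ⊆ {z | L z = 0} := by
      refine closure_minimal ?_ (isClosed_eq L.continuous continuous_const)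
      rintro z ⟨ψ, hψ, hzψ⟩
      rw [mem_ofPred_eq, hL, ← hweak ψ hψ]
      refine integral_congr_ae ?_
      filter_upwards [hw, grad_eq_gradient_of_isTest hΩo hΩb hψ hzψ] with x h1 h2
      rw [h1, h2, one_mul]
    exact hsub hz
  exact ⟨_, ((isMinimizer_sol hn hΩo hΩb isConductivity_one _).grad_eq isConductivity_one
    hmin).trans hw⟩

end WolffBoundary

/-! ### Density points and essential supports -/

section MeasureTheoretic

variable {n : ℕ}

theorem isClosed_halfSpace (ρ : E n) (t : ℝ) : IsClosed (halfSpace ρ t) :=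
  isClosed_le (continuous_id.inner continuous_const) continuous_const

theorem ball_ae_eq_closedBall (x : E n) {r : ℝ} (hr : 0 < r) :
    Metric.ball x r =ᵐ[volume] Metric.closedBall x r := by
  refine Metric.ball_subset_closedBall.eventuallyLE.antisymm (ae_le_set.2 ?_)
  rw [Metric.closedBall_sdiff_ball]
  exact Measure.addHaar_sphere_of_ne_zero _ x hr.ne'

/-- The Lebesgue density theorem. -/
theorem volume_diff_mtInterior {B : Set (E n)} (hB : NullMeasurableSet B volume) :
    volume (B \ mtInterior B) = 0 := by
  have h := Besicovitch.ae_tendsto_measure_inter_div (volume : Measure (E n)) B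
  rw [ae_restrict_iff'₀ hB] at h
  rw [measure_eq_zero_iff_ae_notMem]
  filter_upwards [h] with x hxt hx
  refine hx.2 ⟨hx.1, (hxt hx.1).congr' ?_⟩
  filter_upwards [self_mem_nhdsWithin] with r hr
  -- The differentiation theorem is about closed balls, the interior about open ones; spheres are
  -- null.
  have hae := ball_ae_eq_closedBall x hr
  rw [measure_congr hae, measure_congr ((ae_eq_refl B).inter hae)]

/-- A point off the closed set has a ball meeting B in a null set, hence density 0. A genuine
inclusion is essential, because the union over marked sets is uncountable and null sets could add
up. -/
theorem mtInterior_subset_of_volume_diff {B H : Set (E n)} (hH : IsClosed H)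
    (hBH : volume (B \ H) = 0) : mtInterior B ⊆ H := by
  intro x hx
  by_contra hxH
  obtain ⟨ε, hε, hball⟩ := Metric.isOpen_iff.1 hH.isOpen_compl x hxH
  have h0 : Tendsto (fun ε : ℝ => volume (B ∩ Metric.ball x ε) / volume (Metric.ball x ε))
      (𝓝[>] 0) (𝓝 0) := by
    refine tendsto_const_nhds.congr' ?_
    filter_upwards [Ioo_mem_nhdsGT hε] with r hr
    have : volume (B ∩ Metric.ball x r) = 0 :=
      measure_mono_null (t := B \ H) (fun y hy => ⟨hy.1, hball (Metric.ball_subset_ball hr.2.le hy.2)⟩)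
        hBH
    rw [this, ENNReal.zero_div]
  exact zero_ne_one (tendsto_nhds_unique h0 hx.2)

/-- By the Lindelöf property countably many of the open sets already have the full union. -/
theorem ae_eq_zero_of_notMem_esssupp {Ω : Set (E n)} (f : E n → ℝ) :
    ∀ᵐ x ∂volume, x ∈ Ω → x ∉ esssupp Ω f → f x = 0 := by
  obtain ⟨T, hTc, hTs, hT⟩ := TopologicalSpace.isOpen_sUnion_countable
    {O | IsOpen O ∧ O ⊆ Ω ∧ ∀ᵐ x ∂(volume.restrict O), f x = 0} fun O hO => hO.1
  have hall : ∀ᵐ x ∂(volume : Measure (E n)), ∀ O ∈ T, x ∈ O → f x = 0 := by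
    rw [ae_ball_iff hTc]
    intro O hO
    exact (ae_restrict_iff' (hTs hO).1.measurableSet).1 (hTs hO).2.2
  filter_upwards [hall] with x hx hxΩ hxD
  have : x ∈ ⋃₀ T := by
    rw [hT]
    by_contra h
    exact hxD ⟨hxΩ, h⟩
  obtain ⟨O, hO, hxO⟩ := this
  exact hx O hO hxO

theorem esssupp_diff_eq_empty {Ω H : Set (E n)} (hΩ : IsOpen Ω) (hH : IsClosed H) {f : E n → ℝ}
    (h : ∀ᵐ x ∂volume, x ∈ Ω → x ∉ H → f x = 0) : esssupp Ω f \ H = ∅ := by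
  rw [eq_empty_iff_forall_notMem]
  rintro x ⟨⟨hxΩ, hxD⟩, hxH⟩
  have ho : IsOpen (Ω \ H) := hΩ.sdiff hH
  refine hxD ⟨Ω \ H, ⟨ho, sdiff_subset, ?_⟩, hxΩ, hxH⟩
  rw [ae_restrict_iff' ho.measurableSet]
  filter_upwards [h] with y hy hyO using hy hyO.1 hyO.2

end MeasureTheoretic

/-! ### Enclosing marked sets in half spaces -/

section Enclosure

variable {n : ℕ} {p : ℝ} [hp : Fact (1 < p)] {Ω : Set (E n)}

theorem norm_inv_norm_smul {v : E n} (hv : v ≠ 0) : ‖‖v‖⁻¹ • v‖ = 1 := by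
  rw [norm_smul, norm_inv, norm_norm, inv_mul_cancel₀ (norm_ne_zero_iff.2 hv)]

/-- This is where dimension at least two enters: Wolff's solutions oscillate orthogonally to their
direction of growth. -/
theorem exists_unit_orthogonal (hn : 2 ≤ n) {e : E n} (he : ‖e‖ = 1) :
    ∃ e' : E n, ‖e'‖ = 1 ∧ inner ℝ e e' = 0 := by
  have hne : (Submodule.span ℝ {e})ᗮ ≠ ⊥ := by
    intro h
    rw [Submodule.orthogonal_eq_bot_iff] at h
    have he0 : e ≠ 0 := fun h0 => by simp [h0] at he
    have h1 := finrank_span_singleton (K := ℝ) he0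
    rw [h, finrank_top, finrank_euclideanSpace_fin] at h1
    omega
  obtain ⟨v, hv, hv0⟩ := Submodule.exists_mem_ne_zero_of_ne_bot hne
  refine ⟨‖v‖⁻¹ • v, norm_inv_norm_smul hv0, ?_⟩
  rw [real_inner_smul_right, Submodule.mem_orthogonal_singleton_iff_inner_right.1 hv, mul_zero]

theorem volume_diff_halfSpace_of_unit (hn : 2 ≤ n) (hΩo : IsOpen Ω) (hΩb : Bornology.IsBounded Ω)
    {σ : E n → ℝ} (hσ : IsConductivity Ω σ) {e : E n} (he : ‖e‖ = 1) {t : ℝ}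
    (hz : ∀ᵐ x ∂(volume.restrict Ω), x ∉ halfSpace e t → σ x = 1) {B : Set (E n)}
    (hB : B ∈ marked p Ω σ) : volume (B \ halfSpace e t) = 0 := by
  have hp1 : 1 < p := hp.out
  have hp0 : 0 < p := by linarith
  have hn0 : 0 < n := by omega
  obtain ⟨e', he', hee'⟩ := exists_unit_orthogonal hn he
  obtain ⟨m, M, hm, hW⟩ := exists_wolff_solution hp1 he he' hee'
  obtain ⟨C, hC0, hC⟩ := exists_bound_of_marked hn0 hΩo hΩb hσ
    (isClosed_halfSpace e t).measurableSet hz hB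
  have hBΩ : B ⊆ Ω := hB.1
  have hM : 0 ≤ M := by
    obtain ⟨u, -, hu, -⟩ := hW 1 one_pos
    have h := (norm_nonneg _).trans (hu 0).2
    simpa using h
  have hΩfin : volume Ω ≠ ⊤ := hΩb.measure_lt_top.ne
  have key : ∀ s, t < s → volume (B ∩ {x | s ≤ inner ℝ x e}) = 0 := by
    intro s hs
    set Bs := B ∩ {x | s ≤ inner ℝ x e} with hBs
    have hBsn : NullMeasurableSet Bs volume := hB.2.1.inter (isClosed_le continuous_const
      (continuous_id.inner continuous_const)).measurableSet.nullMeasurableSet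
    have hBsΩ : Bs ⊆ Ω := inter_subset_left.trans hBΩ
    have hBfin : volume Bs ≠ ⊤ := ((measure_mono hBsΩ).trans_lt hΩfin.lt_top).ne
    have hHfin : volume (Ω ∩ halfSpace e t) ≠ ⊤ :=
      ((measure_mono inter_subset_left).trans_lt hΩfin.lt_top).ne
    -- The gradient of Wolff's solution is at least mτe^{τs} on Bs and at most Mτe^{τt} on Ω ∩ H.
    -- The powers of τ cancel and an exponential gap remains.
    have hbound : ∀ τ : ℝ, 0 < τ → m ^ p * volume.real Bs ≤
        C * M ^ p * volume.real Ω * Real.exp (-(τ * (p * (s - t)))) := by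
      intro τ hτ
      obtain ⟨u, hu1, hu2, hu3⟩ := hW τ hτ
      obtain ⟨f, hf⟩ := exists_grad_sol_eq (p := p) hn0 hΩo hΩb hu1 (hu3 Ω)
      have hCf := hC f
      set g : E n → ℝ := fun x => ‖grad (sol (fun _ => (1 : ℝ)) f) x‖ ^ p with hg
      have hgi : IntegrableOn g Ω := integrable_grad _
      have h1 : (m * (τ * Real.exp (τ * s))) ^ p * volume.real Bs ≤ ∫ x in Bs, g x := by
        rw [mul_comm, ← smul_eq_mul, ← setIntegral_const]
        refine integral_mono_ae (integrableOn_const hBfin) (hgi.mono_set hBsΩ) ?_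
        filter_upwards [ae_restrict_of_ae_restrict_of_subset hBsΩ hf, ae_restrict_mem₀ hBsn]
          with x hx hxB
        simp only [hg]
        rw [hx]
        refine Real.rpow_le_rpow (by positivity) (le_trans ?_ (hu2 x).1) hp0.le
        have : s ≤ inner ℝ e x := by rw [real_inner_comm]; exact hxB.2
        gcongr
      have h2 : ∫ x in Bs, g x ≤ ∫ x in B, g x :=
        setIntegral_mono_set (hgi.mono_set hBΩ) (Eventually.of_forall fun x => by positivity)
          inter_subset_left.eventuallyLE
      have h3 : ∫ x in Ω ∩ halfSpace e t, g x ≤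
          (M * (τ * Real.exp (τ * t))) ^ p * volume.real (Ω ∩ halfSpace e t) := by
        rw [mul_comm, ← smul_eq_mul, ← setIntegral_const]
        refine integral_mono_ae (hgi.mono_set inter_subset_left) (integrableOn_const hHfin) ?_
        filter_upwards [ae_restrict_of_ae_restrict_of_subset inter_subset_left hf,
          ae_restrict_mem (hΩo.measurableSet.inter (isClosed_halfSpace e t).measurableSet)]
          with x hx hxB
        simp only [hg]
        rw [hx]
        refine Real.rpow_le_rpow (norm_nonneg _) ((hu2 x).2.trans ?_) hp0.le
        have : inner ℝ e x ≤ t := by rw [real_inner_comm]; exact hxB.2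
        gcongr
      have h4 : volume.real (Ω ∩ halfSpace e t) ≤ volume.real Ω :=
        measureReal_mono inter_subset_left hΩfin
      have h5 : (m * (τ * Real.exp (τ * s))) ^ p * volume.real Bs ≤
          C * ((M * (τ * Real.exp (τ * t))) ^ p * volume.real Ω) := by
        refine (h1.trans (h2.trans hCf)).trans (mul_le_mul_of_nonneg_left (h3.trans ?_) hC0)
        gcongr
      have e1 : ∀ a c : ℝ, 0 ≤ a → (a * (τ * Real.exp (τ * c))) ^ p =
          a ^ p * (τ ^ p * Real.exp (τ * c * p)) := by
        intro a c ha
        rw [Real.mul_rpow ha (by positivity), Real.mul_rpow hτ.le (Real.exp_pos _).le,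
          ← Real.exp_mul]
      rw [e1 m s hm.le, e1 M t hM] at h5
      have e2 : Real.exp (τ * t * p) =
          Real.exp (τ * s * p) * Real.exp (-(τ * (p * (s - t)))) := by
        rw [← Real.exp_add]; congr 1; ring
      rw [e2] at h5
      have hpos : 0 < τ ^ p * Real.exp (τ * s * p) := by positivity
      refine le_of_mul_le_mul_left ?_ hpos
      linarith
    have hlim : Tendsto (fun τ : ℝ => C * M ^ p * volume.real Ω *
        Real.exp (-(τ * (p * (s - t))))) atTop (𝓝 0) := by
      have h1 : Tendsto (fun τ : ℝ => τ * (p * (s - t))) atTop atTop :=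
        tendsto_id.atTop_mul_const (mul_pos hp0 (sub_pos.2 hs))
      simpa using (Real.tendsto_exp_neg_atTop_nhds_zero.comp h1).const_mul
        (C * M ^ p * volume.real Ω)
    have hle : m ^ p * volume.real Bs ≤ 0 :=
      ge_of_tendsto hlim ((eventually_gt_atTop 0).mono hbound)
    have hz : volume.real Bs = 0 :=
      le_antisymm (nonpos_of_mul_nonpos_right hle (by positivity)) measureReal_nonneg
    exact (measureReal_eq_zero_iff hBfin).1 hz
  have hcover : B \ halfSpace e t ⊆ ⋃ k : ℕ, B ∩ {x | t + 1 / ((k : ℝ) + 1) ≤ inner ℝ x e} := by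
    rintro x ⟨hxB, hxH⟩
    have hxt : t < inner ℝ x e := not_le.1 hxH
    obtain ⟨k, hk⟩ := exists_nat_one_div_lt (sub_pos.2 hxt)
    refine mem_iUnion.2 ⟨k, hxB, ?_⟩
    change t + 1 / ((k : ℝ) + 1) ≤ inner ℝ x e
    linarith
  refine measure_mono_null hcover (measure_iUnion_null fun k => key _ ?_)
  have : (0 : ℝ) < 1 / ((k : ℝ) + 1) := by positivity
  linarith

theorem halfSpace_eq_unit {ρ : E n} (hρ : ρ ≠ 0) (t : ℝ) :
    halfSpace ρ t = halfSpace (‖ρ‖⁻¹ • ρ) (‖ρ‖⁻¹ * t) := by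
  have h : 0 < ‖ρ‖⁻¹ := inv_pos.2 (norm_pos_iff.2 hρ)
  ext x
  change inner ℝ x ρ ≤ t ↔ inner ℝ x (‖ρ‖⁻¹ • ρ) ≤ ‖ρ‖⁻¹ * t
  rw [real_inner_smul_right, mul_le_mul_iff_right₀ h]

theorem volume_diff_halfSpace (hn : 2 ≤ n) (hΩo : IsOpen Ω) (hΩb : Bornology.IsBounded Ω)
    {σ : E n → ℝ} (hσ : IsConductivity Ω σ) {ρ : E n} {t : ℝ}
    (hz : ∀ᵐ x ∂(volume.restrict Ω), x ∉ halfSpace ρ t → σ x = 1) {B : Set (E n)}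
    (hB : B ∈ marked p Ω σ) : volume (B \ halfSpace ρ t) = 0 := by
  rcases eq_or_ne ρ 0 with rfl | hρ
  · rcases le_or_gt 0 t with ht | ht
    · have : B \ halfSpace (0 : E n) t = ∅ := by
        rw [sdiff_eq_empty]
        intro x _
        simpa [halfSpace] using ht
      rw [this, measure_empty]
    -- This half space is empty, so σ = 1 a.e. in Ω. A half space with unit normal that misses Ω
    -- takes its place and shows that B is null.
    · have hempty : ∀ x : E n, x ∉ halfSpace (0 : E n) t := fun x => by simpa [halfSpace] using ht
      obtain ⟨R, -, hR⟩ := hΩb.exists_pos_norm_le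
      set e : E n := EuclideanSpace.single ⟨0, by omega⟩ (1 : ℝ) with he_def
      have he : ‖e‖ = 1 := by simp [he_def]
      have hΩe : ∀ x ∈ Ω, x ∉ halfSpace e (-R - 1) := by
        intro x hx hxe
        have h1 : inner ℝ x e ≤ -R - 1 := hxe
        have h2 := (abs_le.1 (abs_real_inner_le_norm x e)).1
        rw [he, mul_one] at h2
        linarith [hR x hx]
      have h := volume_diff_halfSpace_of_unit hn hΩo hΩb hσ he (t := -R - 1)
        (by filter_upwards [hz] with x hx _ using hx (hempty x)) hB
      exact measure_mono_null (t := B \ halfSpace e (-R - 1)) (fun x hx => ⟨hx.1, hΩe x (hB.1 hx.1)⟩)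
        h
  · rw [halfSpace_eq_unit hρ] at hz ⊢
    exact volume_diff_halfSpace_of_unit hn hΩo hΩb hσ (norm_inv_norm_smul hρ) hz hB

/-- σ agrees with a Borel function only almost everywhere in Ω, so its level sets are Lebesgue but
perhaps not Borel measurable. -/
theorem nullMeasurableSet_inter_preimage (hΩo : IsOpen Ω) {σ : E n → ℝ} (hσ : IsConductivity Ω σ)
    {s : Set ℝ} (hs : MeasurableSet s) : NullMeasurableSet (Ω ∩ σ ⁻¹' s) volume := by
  obtain ⟨g, hg, hσg⟩ := hσ.1.1.aemeasurable
  rw [Filter.EventuallyEq, ae_restrict_iff' hΩo.measurableSet] at hσg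
  refine (hΩo.measurableSet.inter (hg hs)).nullMeasurableSet.congr ?_
  filter_upwards [hσg] with x hx
  refine propext ⟨fun h => ⟨h.1, ?_⟩, fun h => ⟨h.1, ?_⟩⟩
  · have h2 : g x ∈ s := h.2
    rw [← hx h.1] at h2
    exact h2
  · have h2 : σ x ∈ s := h.2
    rw [hx h.1] at h2
    exact h2

/-- If the union of the interiors of the marked sets lies in a closed set up to a null set, then
the conductivity is `1` almost everywhere outside of it. -/
theorem ae_eq_one_of_volume_diff (hn : 0 < n) (hΩo : IsOpen Ω) (hΩb : Bornology.IsBounded Ω)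
    {σ : E n → ℝ} (hσ : IsConductivity Ω σ)
    (hmono : (∀ᵐ x ∂(volume.restrict Ω), 1 ≤ σ x) ∨ (∀ᵐ x ∂(volume.restrict Ω), σ x ≤ 1))
    {H : Set (E n)} (h : volume ((⋃ B ∈ marked p Ω σ, mtInterior B) \ H) = 0) :
    ∀ᵐ x ∂volume, x ∈ Ω → x ∉ H → σ x = 1 := by
  have hnull : ∀ B ∈ marked p Ω σ, ∀ᵐ x ∂volume, x ∉ H → x ∉ B := by
    intro B hB
    have h1 : volume (B \ H) = 0 := by
      refine measure_mono_null (t := (B \ mtInterior B) ∪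
        ((⋃ B ∈ marked p Ω σ, mtInterior B) \ H)) (fun x hx => ?_)
        (measure_union_null (volume_diff_mtInterior hB.2.1) h)
      by_cases hxi : x ∈ mtInterior B
      · exact Or.inr ⟨mem_biUnion hB hxi, hx.2⟩
      · exact Or.inl ⟨hx.1, hxi⟩
    filter_upwards [measure_eq_zero_iff_ae_notMem.1 h1] with x hx hxH hxB using hx ⟨hxB, hxH⟩
  -- The thresholds 1/(k+1) exhaust {σ ≠ 1} by countably many marked sets, so their exceptional null
  -- sets can be united.
  have hk : ∀ k : ℕ, (0 : ℝ) < 1 / ((k : ℝ) + 1) := fun k => by positivity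
  rcases hmono with hmono | hmono
  · have hall : ∀ᵐ x ∂volume, ∀ k : ℕ, x ∉ H → x ∉ Ω ∩ σ ⁻¹' Ici (1 + 1 / ((k : ℝ) + 1)) :=
      ae_all_iff.2 fun k => hnull _ (mem_marked_of_le hn hΩo hΩb hσ hmono inter_subset_left
        (nullMeasurableSet_inter_preimage hΩo hσ measurableSet_Ici) (hk k) fun x hx => hx.2)
    rw [ae_restrict_iff' hΩo.measurableSet] at hmono
    filter_upwards [hall, hmono] with x hx hx1 hxΩ hxH
    refine le_antisymm (not_lt.1 fun hlt => ?_) (hx1 hxΩ)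
    obtain ⟨k, hk⟩ := exists_nat_one_div_lt (sub_pos.2 hlt)
    refine hx k hxH ⟨hxΩ, ?_⟩
    change 1 + 1 / ((k : ℝ) + 1) ≤ σ x
    linarith
  · have hall : ∀ᵐ x ∂volume, ∀ k : ℕ, x ∉ H → x ∉ Ω ∩ σ ⁻¹' Iic (1 - 1 / ((k : ℝ) + 1)) :=
      ae_all_iff.2 fun k => hnull _ (mem_marked_of_ge hn hΩo hΩb hσ hmono inter_subset_left
        (nullMeasurableSet_inter_preimage hΩo hσ measurableSet_Iic) (hk k) fun x hx => hx.2)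
    rw [ae_restrict_iff' hΩo.measurableSet] at hmono
    filter_upwards [hall, hmono] with x hx hx1 hxΩ hxH
    refine le_antisymm (hx1 hxΩ) (not_lt.1 fun hlt => ?_)
    obtain ⟨k, hk⟩ := exists_nat_one_div_lt (sub_pos.2 hlt)
    refine hx k hxH ⟨hxΩ, ?_⟩
    change σ x ≤ 1 - 1 / ((k : ℝ) + 1)
    linarith

end Enclosure

end PCalderon

/-! ### Equality of the two convex hulls -/

theorem corollary3p2 {n : ℕ} (hn : 2 ≤ n) (p : ℝ) [Fact (1 < p)]
    (Ω : Set (PCalderon.E n)) (hΩo : IsOpen Ω) (hΩb : Bornology.IsBounded Ω)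
    (σ : PCalderon.E n → ℝ) (hσ : PCalderon.IsConductivity Ω σ)
    (hmono : (∀ᵐ x ∂(volume.restrict Ω), 1 ≤ σ x) ∨ (∀ᵐ x ∂(volume.restrict Ω), σ x ≤ 1)) :
    PCalderon.cessco (PCalderon.esssupp Ω (fun x => |σ x - 1|)) =
      PCalderon.cessco (⋃ B ∈ PCalderon.marked p Ω σ, PCalderon.mtInterior B) := by
  -- Each inclusion of hulls reduces to showing that a half space admissible for the larger hull is
  -- admissible for the smaller one.
  refine Subset.antisymm (fun x hx ρ t h => hx ρ t ?_) (fun x hx ρ t h => hx ρ t ?_)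
  · rw [PCalderon.esssupp_diff_eq_empty hΩo (PCalderon.isClosed_halfSpace ρ t), measure_empty]
    filter_upwards [PCalderon.ae_eq_one_of_volume_diff (by omega) hΩo hΩb hσ hmono h]
      with y hy hyΩ hyH
    rw [hy hyΩ hyH, sub_self, abs_zero]
  · have hz : ∀ᵐ x ∂(volume.restrict Ω), x ∉ PCalderon.halfSpace ρ t → σ x = 1 := by
      rw [ae_restrict_iff' hΩo.measurableSet]
      filter_upwards [PCalderon.ae_eq_zero_of_notMem_esssupp (Ω := Ω) fun x => |σ x - 1|,
        measure_eq_zero_iff_ae_notMem.1 h] with y hy1 hy2 hyΩ hyH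
      exact sub_eq_zero.1 (abs_eq_zero.1 (hy1 hyΩ fun hyD => hy2 ⟨hyD, hyH⟩))
    have hsub : (⋃ B ∈ PCalderon.marked p Ω σ, PCalderon.mtInterior B) ⊆
        PCalderon.halfSpace ρ t :=
      iUnion₂_subset fun B hB => PCalderon.mtInterior_subset_of_volume_diff
        (PCalderon.isClosed_halfSpace ρ t) (PCalderon.volume_diff_halfSpace hn hΩo hΩb hσ hz hB)
    rw [sdiff_eq_empty.2 hsub, measure_empty]
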